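/- Let $(M,g)$ be a connected pseudo-Riemannian $C^\infty$ manifold (finite-dimensional, $g$ of any signature). A complex vector field on $M$ is a section $w=u+iv$ of the complexified tangent bundle $TM^{\mathbb C}$, where $u=\operatorname{Re}w$ and $v=\operatorname{Im}w$ are real vector fields; the Lie bracket and $g$ are extended to complex vector fields complex-bilinearly. Let $\mathfrak z$ be a complex Lie algebra of $C^\infty$ complex vector fields on $M$ (a complex vector space of such fields, closed under the Lie bracket) which trivializes $TM^{\mathbb C}$, that is, for every $x\in M$ the evaluation map $w\mapsto w(x)$ is an isomorphism $\mathfrak z\to T_xM^{\mathbb C}$. Suppose that $g(u,v)$ is a constant function on $M$ for any $u,v\in\mathfrak z$. Then: (a) $(M,g)$ is locally homogeneous: for any $x,y\in M$ there is a $C^\infty$ isometry, sending $x$ to $y$, of an open neighborhood of $x$ onto an open neighborhood of $y$. (b) If, in addition, $[u,v]=0$ for every $u\in\mathfrak z$ and every real Killing field $v$ (that is, $C^\infty$ real vector field with $\mathcal L_vg=0$) defined on any open subset of $M$, then $\operatorname{Re}w\in\mathfrak z$ whenever $w\in\mathfrak z$; that is, $\mathfrak z$ admits a real form: there is a real Lie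 algebra $\mathfrak x$ of $C^\infty$ real vector fields on $M$ such that $\mathfrak z=\mathfrak x+i\mathfrak x$ and, for every $x\in M$, evaluation at $x$ is an isomorphism $\mathfrak x\to T_xM$. -/

import Mathlib

open scoped Manifold ContDiff

noncomputable section

/-- The complexification `V ⊕ iV` of a real vector space `V`; the pair `⟨a, b⟩` stands for
`a + i b`. -/
@[ext]
structure Complexification (V : Type*) where
  /-- The real part. -/
  re : V
  /-- The imaginary part. -/
  im : V

namespace Complexification

variable {V : Type*} [AddCommGroup V]

instance : Zero (Complexification V) := ⟨⟨0, 0⟩⟩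
instance : Add (Complexification V) := ⟨fun v w => ⟨v.re + w.re, v.im + w.im⟩⟩
instance : Neg (Complexification V) := ⟨fun v => ⟨-v.re, -v.im⟩⟩

@[simp] theorem zero_re : (0 : Complexification V).re = 0 := rfl
@[simp] theorem zero_im : (0 : Complexification V).im = 0 := rfl
@[simp] theorem add_re (v w : Complexification V) : (v + w).re = v.re + w.re := rfl
@[simp] theorem add_im (v w : Complexification V) : (v + w).im = v.im + w.im := rfl
@[simp] theorem neg_re (v : Complexification V) : (-v).re = -v.re := rfl
@[simp] theorem neg_im (v : Complexification V) : (-v).im = -v.im := rfl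
instance : AddCommGroup (Complexification V) where
  add_assoc u v w := by ext <;> simp [add_assoc]
  zero_add v := by ext <;> simp
  add_zero v := by ext <;> simp
  add_comm v w := by ext <;> simp [add_comm]
  neg_add_cancel v := by ext <;> simp
  nsmul := nsmulRec
  zsmul := zsmulRec

variable [Module ℝ V]

/-- `(s + i t) (a + i b) = (s a - t b) + i (s b + t a)`. -/
instance : SMul ℂ (Complexification V) :=
  ⟨fun c v => ⟨c.re • v.re - c.im • v.im, c.re • v.im + c.im • v.re⟩⟩

@[simp] theorem smul_re (c : ℂ) (v : Complexification V) :
    (c • v).re = c.re • v.re - c.im • v.im := rfl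
@[simp] theorem smul_im (c : ℂ) (v : Complexification V) :
    (c • v).im = c.re • v.im + c.im • v.re := rfl

instance : Module ℂ (Complexification V) where
  one_smul v := by ext <;> simp
  mul_smul c d v := by ext <;> simp <;> module
  smul_zero c := by ext <;> simp
  smul_add c v w := by ext <;> simp <;> module
  add_smul c d v := by ext <;> simp <;> module
  zero_smul v := by ext <;> simp

end Complexification

section Manifolds

variable {E : Type*} [NormedAddCommGroup E] [NormedSpace ℝ E]
  {M : Type*} [TopologicalSpace M] [ChartedSpace E M]

variable (E M) in
/-- (Not necessarily continuous) real vector fields on a manifold `M` modelled on `E`. -/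
abbrev RealVF : Type _ := Π x : M, TangentSpace 𝓘(ℝ, E) x

variable (E M) in
/-- (Not necessarily continuous) complex vector fields on `M`, i.e. sections of the complexified
tangent bundle. -/
abbrev ComplexVF : Type _ := Π x : M, Complexification (TangentSpace 𝓘(ℝ, E) x)

/-- A real vector field, regarded as a complex one. -/
def RealVF.toComplex (v : RealVF E M) : ComplexVF E M := fun x => ⟨v x, 0⟩

namespace ComplexVF

/-- The real part of a complex vector field, as a real vector field. -/
def re (w : ComplexVF E M) : RealVF E M := fun x => (w x).re

/-- The imaginary part of a complex vector field, as a real vector field. -/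
def im (w : ComplexVF E M) : RealVF E M := fun x => (w x).im

/-- The complex-bilinear extension of the Lie bracket of vector fields:
`[a + ib, c + id] = [a, c] - [b, d] + i ([a, d] + [b, c])`. -/
def bracket (v w : ComplexVF E M) : ComplexVF E M := fun x =>
  ⟨VectorField.mlieBracket 𝓘(ℝ, E) (re v) (re w) x
      - VectorField.mlieBracket 𝓘(ℝ, E) (im v) (im w) x,
    VectorField.mlieBracket 𝓘(ℝ, E) (re v) (im w) x
      + VectorField.mlieBracket 𝓘(ℝ, E) (im v) (re w) x⟩

end ComplexVF

variable [IsManifold 𝓘(ℝ, E) ∞ M]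

/-- A real vector field of class `C^∞` on the subset `U`. -/
def RealVF.SmoothOn (v : RealVF E M) (U : Set M) : Prop :=
  ContMDiffOn 𝓘(ℝ, E) 𝓘(ℝ, E).tangent ∞ (fun x => (⟨x, v x⟩ : TangentBundle 𝓘(ℝ, E) M)) U

/-- A real vector field of class `C^∞`. -/
def RealVF.Smooth (v : RealVF E M) : Prop :=
  ContMDiff 𝓘(ℝ, E) 𝓘(ℝ, E).tangent ∞ (fun x => (⟨x, v x⟩ : TangentBundle 𝓘(ℝ, E) M))

/-- A complex vector field of class `C^∞`: both its real and its imaginary part are `C^∞`. -/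
def ComplexVF.Smooth (w : ComplexVF E M) : Prop :=
  RealVF.Smooth (ComplexVF.re w) ∧ RealVF.Smooth (ComplexVF.im w)

/-- A real Lie algebra of `C^∞` real vector fields on `M`. -/
structure IsRealLieAlgebra (X : Submodule ℝ (RealVF E M)) : Prop where
  smooth : ∀ v ∈ X, RealVF.Smooth v
  bracket_mem : ∀ v ∈ X, ∀ w ∈ X, VectorField.mlieBracket 𝓘(ℝ, E) v w ∈ X

/-- A complex Lie algebra of `C^∞` complex vector fields on `M`. -/
structure IsComplexLieAlgebra (Z : Submodule ℂ (ComplexVF E M)) : Prop where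
  smooth : ∀ v ∈ Z, ComplexVF.Smooth v
  bracket_mem : ∀ v ∈ Z, ∀ w ∈ Z, ComplexVF.bracket v w ∈ Z

/-- A space `X` of `C^∞` real vector fields trivializes the tangent bundle: for every `x`, the
evaluation operator at `x` is an isomorphism from `X` onto the tangent space. -/
def TrivializesReal (X : Submodule ℝ (RealVF E M)) : Prop :=
  (∀ v ∈ X, RealVF.Smooth v) ∧
    ∀ x : M, Function.Bijective (fun v : X => (v : RealVF E M) x)

/-- A space `Z` of `C^∞` complex vector fields trivializes the complexified tangent bundle: for
every `x`, the evaluation operator at `x` is an isomorphism from `Z` onto the complexified tangent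
space. -/
def TrivializesComplex (Z : Submodule ℂ (ComplexVF E M)) : Prop :=
  (∀ v ∈ Z, ComplexVF.Smooth v) ∧
    ∀ x : M, Function.Bijective (fun v : Z => (v : ComplexVF E M) x)

/-- `Z` is closed under taking real parts of vector fields. -/
def ClosedUnderRe (Z : Submodule ℂ (ComplexVF E M)) : Prop :=
  ∀ w ∈ Z, RealVF.toComplex (ComplexVF.re w) ∈ Z

/-- `X` is a real form of `Z`: a real Lie algebra of real vector fields, trivializing the tangent
bundle, such that `Z = X + iX`. -/
structure IsRealForm (X : Submodule ℝ (RealVF E M)) (Z : Submodule ℂ (ComplexVF E M)) : Prop where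
  isRealLieAlgebra : IsRealLieAlgebra X
  trivializes : TrivializesReal X
  mem_iff : ∀ w : ComplexVF E M, w ∈ Z ↔
    ∃ a ∈ X, ∃ b ∈ X, w = RealVF.toComplex a + Complex.I • RealVF.toComplex b

variable (E M) in
/-- A (`C^∞`) pseudo-Riemannian metric on a manifold `M` modelled on `E`: a smooth field of
nondegenerate symmetric bilinear forms on the tangent spaces, of any signature. -/
structure PseudoRiemannianMetric where
  /-- The bilinear form on the tangent space at `x`. -/
  val (x : M) : TangentSpace 𝓘(ℝ, E) x →L[ℝ] TangentSpace 𝓘(ℝ, E) x →L[ℝ] ℝ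
  symm (x : M) (v w : TangentSpace 𝓘(ℝ, E) x) : val x v w = val x w v
  nondegenerate (x : M) (v : TangentSpace 𝓘(ℝ, E) x) (hv : ∀ w, val x v w = 0) : v = 0
  contMDiff : ContMDiff 𝓘(ℝ, E) (𝓘(ℝ, E).prod 𝓘(ℝ, E →L[ℝ] E →L[ℝ] ℝ)) ∞
    (fun x => Bundle.TotalSpace.mk' (E →L[ℝ] E →L[ℝ] ℝ)
      (E := fun x : M => TangentSpace 𝓘(ℝ, E) x →L[ℝ] TangentSpace 𝓘(ℝ, E) x →L[ℝ] ℝ) x (val x))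

namespace PseudoRiemannianMetric

variable (g : PseudoRiemannianMetric E M)

/-- The complex-bilinear extension of the metric to the complexified tangent space at `x`. -/
def complexVal (x : M) (v w : Complexification (TangentSpace 𝓘(ℝ, E) x)) : ℂ :=
  ⟨g.val x v.re w.re - g.val x v.im w.im, g.val x v.re w.im + g.val x v.im w.re⟩

/-- The Lie derivative of the metric in the direction of `v`, on vector fields `X`, `Y`, at `x`:
`(L_v g)(X, Y) = d_v (g(X, Y)) - g([v, X], Y) - g(X, [v, Y])`. -/
def lieDeriv (v X Y : RealVF E M) (x : M) : ℝ :=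
  mvfderiv 𝓘(ℝ, E) (fun p => g.val p (X p) (Y p)) x (v x)
    - g.val x (VectorField.mlieBracket 𝓘(ℝ, E) v X x) (Y x)
    - g.val x (X x) (VectorField.mlieBracket 𝓘(ℝ, E) v Y x)

/-- `v` is a (real) Killing field on the open set `U`: it is `C^∞` on `U` and `L_v g = 0` there.
Only the values of `v` on `U` matter. -/
structure IsKillingOn (v : RealVF E M) (U : Set M) : Prop where
  smooth : RealVF.SmoothOn v U
  lieDeriv_eq_zero : ∀ X Y : RealVF E M, ∀ x ∈ U,
    ContMDiffAt 𝓘(ℝ, E) 𝓘(ℝ, E).tangent ∞ (fun p => (⟨p, X p⟩ : TangentBundle 𝓘(ℝ, E) M)) x →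
    ContMDiffAt 𝓘(ℝ, E) 𝓘(ℝ, E).tangent ∞ (fun p => (⟨p, Y p⟩ : TangentBundle 𝓘(ℝ, E) M)) x →
    g.lieDeriv v X Y x = 0

/-- `(M, g)` is locally homogeneous: for any two points `x`, `y` of `M` there is an isometry `φ`
between open subsets of `M`, with `x` in its domain and `φ x = y`. -/
def LocallyHomogeneous : Prop :=
  ∀ x y : M, ∃ φ : OpenPartialHomeomorph M M, x ∈ φ.source ∧ φ x = y ∧
    ContMDiffOn 𝓘(ℝ, E) 𝓘(ℝ, E) ∞ φ φ.source ∧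
    ContMDiffOn 𝓘(ℝ, E) 𝓘(ℝ, E) ∞ φ.symm φ.target ∧
    ∀ p ∈ φ.source, ∀ u v : TangentSpace 𝓘(ℝ, E) p,
      g.val (φ p) (mfderiv 𝓘(ℝ, E) 𝓘(ℝ, E) φ p u) (mfderiv 𝓘(ℝ, E) 𝓘(ℝ, E) φ p v) = g.val p u v

end PseudoRiemannianMetric

end Manifolds

end

/-! In a chart, the elements of 𝔷 are parametrized by a complex vector space `F`. For a real tangent
vector v at p, let θ_p(v) in `F` be the parameter of the element of 𝔷 whose value at p is v; this is
`ComplexFrame.form`. Since g is constant on 𝔷, it has the form g(v, w) = h(θ v, θ w) with a constant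
complex-bilinear form h. Closure of 𝔷 under the bracket becomes the Maurer-Cartan equation dθ = -[θ,
θ] (`maurerCartan`).

A complex field with variable parameter f commutes with 𝔷 exactly when df = -[θ, f]. By
Maurer-Cartan and Jacobi this linear system is flat, so near any point it has solutions with an
arbitrary value there (`exists_commuting`). If a + ib is such a field, then L_a θ + i L_b θ = 0,
hence L_a g + i L_b g = 0. Both Lie derivatives are real, so L_a g = 0: the real part a is a Killing
field (`lieForm_metric_eq_zero`).

For (a): these Killing fields take every value at a given point, so their flows carry the point to
all nearby ones by local isometries (`eventually_exists_local_isometry`). Being related by a local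
isometry is an equivalence relation, and connectedness concludes.

For (b): if 𝔷 commutes with all such Killing fields X, then L_X θ = 0 and [X, Re w] = 0, so θ(Re w)
has zero derivative along every X, that is, in every direction. Thus θ(Re w) is locally constant,
hence constant, which means that Re w lies in 𝔷 (`closedUnderRe_of_commute`).

The analytic input is smooth dependence of solutions of ordinary differential equations on
parameters and initial values, obtained by applying the inverse function theorem to the integral
equation in the Banach space of continuous curves. -/

noncomputable section

open scoped Topology unitInterval
open Set Filter

/-! ### Smooth local inverses and cut-offs -/

section InverseFunction

variable {E F : Type*} [NormedAddCommGroup E] [NormedSpace ℝ E] [CompleteSpace E]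
  [NormedAddCommGroup F] [NormedSpace ℝ F]

/-- The `C^∞` inverse function theorem, with a local inverse that is `C^∞` on its whole domain. -/
theorem ContDiffOn.exists_openPartialHomeomorph {f : E → F} {U : Set E} (hU : IsOpen U)
    (hf : ContDiffOn ℝ ∞ f U) {x : E} (hx : x ∈ U) {f' : E ≃L[ℝ] F}
    (hf' : HasFDerivAt f (f' : E →L[ℝ] F) x) :
    ∃ e : OpenPartialHomeomorph E F, x ∈ e.source ∧ e.source ⊆ U ∧ ⇑e = f ∧
      ContDiffOn ℝ ∞ e.symm e.target := by
  have hfx : ContDiffAt ℝ ∞ f x := hf.contDiffAt (hU.mem_nhds hx)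
  set e₀ := hfx.toOpenPartialHomeomorph f hf' (by simp)
  -- The points with invertible derivative form an open set; restricting to it makes the inverse
  -- smooth on its whole domain and not only at `f x`.
  set V : Set E := U ∩ fderiv ℝ f ⁻¹' range ((↑) : (E ≃L[ℝ] F) → E →L[ℝ] F)
  have hV : IsOpen V :=
    (hf.continuousOn_fderiv_of_isOpen hU (by simp)).isOpen_inter_preimage hU
      ContinuousLinearEquiv.isOpen
  have hxV : x ∈ V := ⟨hx, f', hf'.fderiv.symm⟩
  refine ⟨e₀.restrOpen V hV, ⟨hfx.mem_toOpenPartialHomeomorph_source hf' (by simp), hxV⟩,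
    fun y hy => hy.2.1, rfl, fun a ha => ?_⟩
  have hy := (e₀.restrOpen V hV).map_target ha
  obtain ⟨g, hg⟩ := hy.2.2
  have hc := hf.contDiffAt (hU.mem_nhds hy.2.1)
  refine ((e₀.restrOpen V hV).contDiffAt_symm (f₀' := g) ha ?_ hc).contDiffWithinAt
  rw [hg]
  exact (hc.differentiableAt (by simp)).hasFDerivAt

end InverseFunction

/-- Multiplication by a bump function. Composition with arbitrary curves requires a map defined on
the whole space, so a coefficient given on an open set is first replaced by such a map. -/
theorem ContDiffOn.exists_contDiff_eventuallyEq {E F : Type*} [NormedAddCommGroup E]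
    [NormedSpace ℝ E] [FiniteDimensional ℝ E] [NormedAddCommGroup F] [NormedSpace ℝ F]
    {f : E → F} {T : Set E} (hf : ContDiffOn ℝ ∞ f T) {x : E} (hT : T ∈ 𝓝 x) :
    ∃ g : E → F, ContDiff ℝ ∞ g ∧ g =ᶠ[𝓝 x] f := by
  obtain ⟨r, hr, hrT⟩ := Metric.nhds_basis_closedBall.mem_iff.1 (interior_mem_nhds.2 hT)
  let χ : ContDiffBump x := ⟨r / 2, r, by positivity, by linarith⟩
  refine ⟨fun y => χ y • f y, contDiff_iff_contDiffAt.2 fun y => ?_, ?_⟩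
  · by_cases hy : y ∈ Metric.closedBall x r
    · exact χ.contDiffAt.smul (hf.contDiffAt (mem_interior_iff_mem_nhds.1 (hrT hy)))
    · refine (contDiffAt_const (c := (0 : F))).congr_of_eventuallyEq ?_
      filter_upwards [Metric.isClosed_closedBall.isOpen_compl.mem_nhds hy] with z hz
      rw [χ.zero_of_le_dist, zero_smul]
      simpa [χ] using (not_le.1 (mt Metric.mem_closedBall.2 hz)).le
  · filter_upwards [χ.eventuallyEq_one] with y hy
    simp [hy]

/-! ### The Banach space of curves and the integral equation of an ODE -/

/-- Continuous curves, parametrized by the unit interval, in a normed space. -/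
def Curve (E : Type*) [NormedAddCommGroup E] : Type _ := C(I, E)

namespace Curve

section Basic

variable {E F : Type*} [NormedAddCommGroup E] [NormedAddCommGroup F]

instance : NormedAddCommGroup (Curve E) := inferInstanceAs (NormedAddCommGroup C(I, E))
instance [NormedSpace ℝ E] : NormedSpace ℝ (Curve E) := inferInstanceAs (NormedSpace ℝ C(I, E))
instance [CompleteSpace E] : CompleteSpace (Curve E) := inferInstanceAs (CompleteSpace C(I, E))
instance : FunLike (Curve E) I E := inferInstanceAs (FunLike C(I, E) I E)

/-- The curve with a given continuous parametrization. -/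
def mk (f : I → E) (hf : Continuous f) : Curve E := (⟨f, hf⟩ : C(I, E))

@[simp] theorem mk_apply (f : I → E) (hf : Continuous f) (t : I) : mk f hf t = f t := rfl
@[simp] theorem add_apply (φ ψ : Curve E) (t : I) : (φ + ψ) t = φ t + ψ t := rfl
@[simp] theorem sub_apply (φ ψ : Curve E) (t : I) : (φ - ψ) t = φ t - ψ t := rfl
@[simp] theorem smul_apply [NormedSpace ℝ E] (c : ℝ) (φ : Curve E) (t : I) :
    (c • φ) t = c • φ t := rfl

@[ext] theorem ext {φ ψ : Curve E} (h : ∀ t, φ t = ψ t) : φ = ψ := ContinuousMap.ext h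

@[fun_prop] theorem continuous (φ : Curve E) : Continuous φ := ContinuousMap.continuous φ

theorem norm_le (φ : Curve E) {C : ℝ} (hC : 0 ≤ C) : ‖φ‖ ≤ C ↔ ∀ t, ‖φ t‖ ≤ C :=
  ContinuousMap.norm_le (α := I) (E := E) φ hC

theorem norm_coe_le_norm (φ : Curve E) (t : I) : ‖φ t‖ ≤ ‖φ‖ :=
  ContinuousMap.norm_coe_le_norm (α := I) (E := E) φ t

/-- Composition with a continuous map. -/
def postcomp (f : C(E, F)) (φ : Curve E) : Curve F := mk (fun t => f (φ t)) (by fun_prop)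

@[simp] theorem postcomp_apply (f : C(E, F)) (φ : Curve E) (t : I) : postcomp f φ t = f (φ t) := rfl

theorem continuous_postcomp (f : C(E, F)) : Continuous (postcomp f) :=
  ContinuousMap.continuous_postcomp (X := I) f

variable [NormedSpace ℝ E] [NormedSpace ℝ F]

/-- Constant curves, as a continuous linear map. -/
def const : E →L[ℝ] Curve E :=
  LinearMap.mkContinuous ⟨⟨fun x => mk (fun _ => x) continuous_const, fun _ _ => rfl⟩,
    fun _ _ => rfl⟩ 1 fun x => by
    rw [one_mul]
    exact (norm_le _ (norm_nonneg _)).2 fun _ => le_rfl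

@[simp] theorem const_apply (x : E) (t : I) : const x t = x := rfl

/-- Evaluation at a parameter value, as a continuous linear map. -/
def eval (t : I) : Curve E →L[ℝ] E :=
  LinearMap.mkContinuous ⟨⟨fun φ => φ t, fun _ _ => rfl⟩, fun _ _ => rfl⟩ 1 fun φ => by
    rw [one_mul]
    exact φ.norm_coe_le_norm t

@[simp] theorem eval_apply (t : I) (φ : Curve E) : eval t φ = φ t := rfl

/-- Pointwise application of a curve of operators to a curve of vectors. -/
def app : Curve (E →L[ℝ] F) →L[ℝ] Curve E →L[ℝ] Curve F :=
  LinearMap.mkContinuous₂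
    (LinearMap.mk₂ ℝ (fun (L : Curve (E →L[ℝ] F)) (φ : Curve E) =>
      mk (fun t => L t (φ t)) (by fun_prop))
      (fun _ _ _ => by ext; simp) (fun _ _ _ => by ext; simp)
      (fun _ _ _ => by ext; simp) (fun _ _ _ => by ext; simp)) 1 (fun L φ => by
    rw [one_mul, norm_le _ (by positivity)]
    exact fun t => (L t).le_of_opNorm_le_of_le (L.norm_coe_le_norm t) (φ.norm_coe_le_norm t))

@[simp] theorem app_apply (L : Curve (E →L[ℝ] F)) (φ : Curve E) (t : I) :
    app L φ t = L t (φ t) := rfl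

/-- Continuity of composition with `f'` at `φ` provides one radius δ within which `f'` varies by at
most ε around every point of the curve; the mean value inequality on each δ-ball then bounds the
remainder uniformly in `t`. -/
theorem hasFDerivAt_postcomp (f : C(E, F)) (f' : C(E, E →L[ℝ] F))
    (hf : ∀ x, HasFDerivAt f (f' x) x) (φ : Curve E) :
    HasFDerivAt (postcomp f) (app (postcomp f' φ)) φ := by
  rw [hasFDerivAt_iff_isLittleO_nhds_zero, Asymptotics.isLittleO_iff]
  intro ε hε
  obtain ⟨δ, hδ, hball⟩ := Metric.continuousAt_iff.1 (continuous_postcomp f').continuousAt ε hε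
  filter_upwards [Metric.ball_mem_nhds (0 : Curve E) hδ] with h hh
  rw [mem_ball_zero_iff] at hh
  rw [norm_le _ (by positivity)]
  intro t
  have key := (convex_ball (φ t) δ).norm_image_sub_le_of_norm_hasFDerivWithin_le' (f := f)
    (f' := f') (φ := f' (φ t)) (C := ε) (x := φ t) (y := φ t + h t)
    (fun y _ => (hf y).hasFDerivWithinAt) (fun y hy => ?_) (Metric.mem_ball_self hδ) ?_
  · refine le_trans ?_ (mul_le_mul_of_nonneg_left (h.norm_coe_le_norm t) hε.le)
    simpa using key
  -- A translate of `φ` passing through `y` at time `t`, used to turn closeness of curves into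
  -- closeness of points.
  · have h1 : dist (φ + const (y - φ t)) φ < δ := by
      rw [dist_eq_norm, add_sub_cancel_left]
      exact lt_of_le_of_lt ((norm_le _ (norm_nonneg _)).2 fun s => le_rfl)
        ((dist_eq_norm y (φ t)).symm.trans_lt hy)
    have h2 := hball h1
    rw [dist_eq_norm] at h2
    simpa using ((norm_coe_le_norm _ t).trans_lt h2).le
  · simpa [dist_eq_norm] using (h.norm_coe_le_norm t).trans_lt hh

end Basic

section Smooth

universe u v

variable {E : Type u} [NormedAddCommGroup E] [NormedSpace ℝ E]

/-- Induction on `n`: the derivative is `app` after composition with `f'`, which has one order of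
smoothness less. The target changes from `F` to `E →L[ℝ] F` along the way, which the universe `max u
v` accommodates. -/
theorem contDiff_nat_postcomp (n : ℕ) : ∀ {F : Type (max u v)} [NormedAddCommGroup F]
    [NormedSpace ℝ F] (f : C(E, F)), ContDiff ℝ n f →
      ContDiff ℝ n (postcomp f : Curve E → Curve F) := by
  induction n with
  | zero =>
    intro F _ _ f _
    exact contDiff_zero.2 (continuous_postcomp f)
  | succ n ih =>
    intro F _ _ f hf
    rw [Nat.cast_add, Nat.cast_one, contDiff_succ_iff_hasFDerivAt]
    let f' : C(E, E →L[ℝ] F) := ⟨fderiv ℝ f, hf.continuous_fderiv (by simp)⟩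
    have hf' : ContDiff ℝ n f' := hf.fderiv_right (by simp)
    exact ⟨fun φ => app (postcomp f' φ), (app (E := E) (F := F)).contDiff.comp (ih f' hf'),
      hasFDerivAt_postcomp f f' fun x => (hf.differentiable (by simp) x).hasFDerivAt⟩

/-- Composition with a fixed `C^∞` map is a `C^∞` operation on continuous curves. -/
theorem contDiff_postcomp {F : Type (max u v)} [NormedAddCommGroup F] [NormedSpace ℝ F]
    (f : C(E, F)) (hf : ContDiff ℝ ∞ f) : ContDiff ℝ ∞ (postcomp f : Curve E → Curve F) :=
  contDiff_infty.2 fun n => contDiff_nat_postcomp.{u, v} n f (hf.of_le (by exact_mod_cast le_top))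

end Smooth

section Primitive

variable {E : Type*} [NormedAddCommGroup E]

/-- The extension of a curve to the real line that is constant on both sides of the unit
interval. -/
def extend (φ : Curve E) (t : ℝ) : E := φ (projIcc 0 1 zero_le_one t)

@[fun_prop] theorem continuous_extend (φ : Curve E) : Continuous φ.extend :=
  φ.continuous.comp continuous_projIcc

theorem extend_of_mem (φ : Curve E) {t : ℝ} (ht : t ∈ Icc (0 : ℝ) 1) : φ.extend t = φ ⟨t, ht⟩ := by
  rw [extend, projIcc_of_mem _ ht]

theorem intervalIntegrable_extend (φ : Curve E) (a b : ℝ) :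
    IntervalIntegrable φ.extend MeasureTheory.volume a b :=
  φ.continuous_extend.intervalIntegrable a b

variable [NormedSpace ℝ E]

/-- The primitive vanishing at `0` of a continuous function on the unit interval. -/
def primitive : Curve E →L[ℝ] Curve E :=
  LinearMap.mkContinuous
    { toFun := fun φ => mk (fun t => ∫ s in (0 : ℝ)..t, φ.extend s)
        ((intervalIntegral.continuous_primitive φ.intervalIntegrable_extend 0).comp
          continuous_subtype_val)
      map_add' := fun φ ψ => by
        ext t
        exact intervalIntegral.integral_add (φ.intervalIntegrable_extend _ _)
          (ψ.intervalIntegrable_extend _ _)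
      map_smul' := fun c φ => by
        ext t
        exact intervalIntegral.integral_smul c _ } 1 (fun φ => by
    rw [one_mul, norm_le _ (norm_nonneg _)]
    intro t
    refine (intervalIntegral.norm_integral_le_of_norm_le_const (C := ‖φ‖) fun s _ =>
      φ.norm_coe_le_norm _).trans ?_
    rw [sub_zero, abs_of_nonneg t.2.1]
    exact mul_le_of_le_one_right (norm_nonneg _) t.2.2)

theorem primitive_apply (φ : Curve E) (t : I) :
    primitive φ t = ∫ s in (0 : ℝ)..t, φ.extend s := rfl

theorem extend_zero_of_eq_primitive {φ Y : Curve E} {c : E}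
    (h : φ = const c + primitive Y) : φ.extend 0 = c := by
  rw [extend_of_mem _ (left_mem_Icc.2 zero_le_one), h]
  simp [primitive_apply]

theorem hasDerivWithinAt_extend_of_eq_primitive [CompleteSpace E] {φ Y : Curve E} {c : E}
    (h : φ = const c + primitive Y) {t : ℝ} (ht : t ∈ Ico (0 : ℝ) 1) :
    HasDerivWithinAt φ.extend (Y.extend t) (Ici t) t := by
  have h1 : HasDerivAt (fun t => c + ∫ s in (0 : ℝ)..t, Y.extend s) (Y.extend t) t :=
    (intervalIntegral.integral_hasDerivAt_right (Y.intervalIntegrable_extend _ _)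
      (Y.continuous_extend.stronglyMeasurableAtFilter _ _)
      Y.continuous_extend.continuousAt).const_add c
  have h2 : HasDerivWithinAt φ.extend (Y.extend t) (Icc 0 1) t := by
    refine h1.hasDerivWithinAt.congr_of_mem (fun s hs => ?_) (Ico_subset_Icc_self ht)
    rw [extend_of_mem _ hs, h]
    rfl
  exact h2.mono_of_mem_nhdsWithin (Icc_mem_nhdsGE_of_mem ht)

end Primitive

section ParametricODE

universe u v

variable {E : Type u} [NormedAddCommGroup E] [NormedSpace ℝ E]
  {P : Type v} [NormedAddCommGroup P] [NormedSpace ℝ P]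

/-- The integral operator whose fixed points `φ` solve `φ' = X (φ) a`, `φ 0 = x`. -/
def integralOperator (X : C(E, P →L[ℝ] E)) (z : (P × E) × Curve E) : Curve E :=
  const z.1.2 + primitive (app (postcomp X z.2) (const z.1.1))

/-- The derivative of `integralOperator`. -/
def integralOperatorDeriv (X : C(E, P →L[ℝ] E)) (X' : C(E, E →L[ℝ] P →L[ℝ] E))
    (z : (P × E) × Curve E) : (P × E) × Curve E →L[ℝ] Curve E :=
  const ∘L .snd ℝ P E ∘L .fst ℝ (P × E) (Curve E) +
    primitive ∘L (app (postcomp X z.2) ∘L const ∘L .fst ℝ P E ∘L .fst ℝ (P × E) (Curve E) +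
      (app ∘L app (postcomp X' z.2) ∘L .snd ℝ (P × E) (Curve E)).flip (const z.1.1))

theorem hasFDerivAt_integralOperator (X : C(E, P →L[ℝ] E)) (X' : C(E, E →L[ℝ] P →L[ℝ] E))
    (hX : ∀ x, HasFDerivAt X (X' x) x) (z : (P × E) × Curve E) :
    HasFDerivAt (integralOperator X) (integralOperatorDeriv X X' z) z := by
  have h1 : HasFDerivAt (fun z : (P × E) × Curve E => postcomp X z.2)
      (app (postcomp X' z.2) ∘L .snd ℝ (P × E) (Curve E)) z :=
    (hasFDerivAt_postcomp X X' hX z.2).comp z hasFDerivAt_snd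
  have h2 := (app (E := P) (F := E)).hasFDerivAt.comp z h1
  have h3 := h2.clm_apply
    (const ∘L .fst ℝ P E ∘L .fst ℝ (P × E) (Curve E)).hasFDerivAt
  exact (const ∘L .snd ℝ P E ∘L .fst ℝ (P × E) (Curve E)).hasFDerivAt.add
    ((primitive (E := E)).hasFDerivAt.comp z h3)

theorem contDiff_integralOperator (X : C(E, P →L[ℝ] E)) (hX : ContDiff ℝ ∞ X) :
    ContDiff ℝ ∞ (integralOperator X) := by
  have h1 : ContDiff ℝ ∞ (fun z : (P × E) × Curve E => postcomp X z.2) :=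
    (contDiff_postcomp.{u, v} X hX).comp contDiff_snd
  have h2 := (app (E := P) (F := E)).contDiff.comp h1
  have h3 := h2.clm_apply
    (const ∘L .fst ℝ P E ∘L .fst ℝ (P × E) (Curve E)).contDiff
  exact (const ∘L .snd ℝ P E ∘L .fst ℝ (P × E) (Curve E)).contDiff.add
    ((primitive (E := E)).contDiff.comp h3)

variable [CompleteSpace E] [CompleteSpace P]

/-- The inverse function theorem for `(q, φ) ↦ (q, φ - integralOperator X (q, φ))`. At parameter `a
= 0` the integral operator has zero derivative in `φ`, so the total derivative is unipotent.
Smallness of `a` plays the role of shortness of time, and solutions exist on all of the unit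
interval. -/
theorem exists_contDiffOn_fixedPoint (X : C(E, P →L[ℝ] E)) (hX : ContDiff ℝ ∞ X) (x₀ : E) :
    ∃ (N : Set (P × E)) (ψ : P × E → Curve E), IsOpen N ∧ (0, x₀) ∈ N ∧ ContDiffOn ℝ ∞ ψ N ∧
      ψ (0, x₀) = const x₀ ∧ ∀ q ∈ N, ψ q = integralOperator X (q, ψ q) := by
  let X' : C(E, E →L[ℝ] P →L[ℝ] E) := ⟨fderiv ℝ X, hX.continuous_fderiv (by simp)⟩
  have hX' : ∀ x, HasFDerivAt X (X' x) x := fun x =>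
    (hX.differentiable (by simp) x).hasFDerivAt
  let z₀ : (P × E) × Curve E := ((0, x₀), const x₀)
  let Φ : (P × E) × Curve E → (P × E) × Curve E := fun z => (z.1, z.2 - integralOperator X z)
  have hΦ : ContDiff ℝ ∞ Φ :=
    contDiff_fst.prodMk (contDiff_snd.sub (contDiff_integralOperator X hX))
  let L : P × E →L[ℝ] Curve E :=
    const ∘L .snd ℝ P E + primitive ∘L app (postcomp X (const x₀)) ∘L const ∘L .fst ℝ P E
  let Φ' : ((P × E) × Curve E) ≃L[ℝ] (P × E) × Curve E :=
    ContinuousLinearEquiv.equivOfInverse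
      ((ContinuousLinearMap.fst ℝ _ _).prod (.snd ℝ _ _ - L ∘L .fst ℝ _ _))
      ((ContinuousLinearMap.fst ℝ _ _).prod (.snd ℝ _ _ + L ∘L .fst ℝ _ _))
      (fun z => by simp) (fun z => by simp)
  have hΦ' : HasFDerivAt Φ (Φ' : (P × E) × Curve E →L[ℝ] (P × E) × Curve E) z₀ := by
    have h := (hasFDerivAt_fst (𝕜 := ℝ) (p := z₀)).prodMk
      ((hasFDerivAt_snd (𝕜 := ℝ) (p := z₀)).sub (hasFDerivAt_integralOperator X X' hX' z₀))
    refine h.congr_fderiv (ContinuousLinearMap.ext fun z => Prod.ext rfl ?_)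
    simp [Φ', L, z₀, integralOperatorDeriv]
  obtain ⟨e, he, -, heΦ, hsymm⟩ := hΦ.contDiffOn.exists_openPartialHomeomorph isOpen_univ
    (mem_univ z₀) hΦ'
  have hz₀ : Φ z₀ = ((0, x₀), 0) := by
    simp [Φ, z₀, integralOperator]
  have hι : ContDiff ℝ ∞ (fun q : P × E => (q, (0 : Curve E))) := contDiff_id.prodMk contDiff_const
  refine ⟨(fun q : P × E => (q, (0 : Curve E))) ⁻¹' e.target, fun q => (e.symm (q, 0)).2,
    e.open_target.preimage hι.continuous, ?_, contDiff_snd.comp_contDiffOn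
      (hsymm.comp hι.contDiffOn fun _ h => h), ?_, fun q hq => ?_⟩
  · rw [mem_preimage, ← hz₀, ← heΦ]
    exact e.map_source he
  · show (e.symm ((0, x₀), 0)).2 = _
    rw [← hz₀, ← heΦ, e.left_inv he]
  · have h1 : Φ (e.symm (q, 0)) = (q, 0) := by rw [← heΦ]; exact e.right_inv hq
    have h2 : (e.symm (q, 0)).1 = q := congrArg Prod.fst h1
    have h3 : (e.symm (q, 0)).2 - integralOperator X (e.symm (q, 0)) = 0 := congrArg Prod.snd h1
    have h4 : e.symm (q, 0) = (q, (e.symm (q, 0)).2) := Prod.ext h2 rfl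
    rw [h4] at h3
    exact sub_eq_zero.1 h3

end ParametricODE

end Curve

end

/-! ### Smooth parametric flows and flat linear systems -/

noncomputable section

open scoped Topology unitInterval
open Set Filter

universe u v

theorem HasDerivWithinAt.fst' {E F : Type*} [NormedAddCommGroup E] [NormedSpace ℝ E]
    [NormedAddCommGroup F] [NormedSpace ℝ F] {f : ℝ → E × F} {f' : E × F} {s : Set ℝ} {t : ℝ}
    (h : HasDerivWithinAt f f' s t) : HasDerivWithinAt (fun t => (f t).1) f'.1 s t :=
  (ContinuousLinearMap.fst ℝ E F).hasFDerivAt.comp_hasDerivWithinAt t h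

theorem HasDerivWithinAt.snd' {E F : Type*} [NormedAddCommGroup E] [NormedSpace ℝ E]
    [NormedAddCommGroup F] [NormedSpace ℝ F] {f : ℝ → E × F} {f' : E × F} {s : Set ℝ} {t : ℝ}
    (h : HasDerivWithinAt f f' s t) : HasDerivWithinAt (fun t => (f t).2) f'.2 s t :=
  (ContinuousLinearMap.snd ℝ E F).hasFDerivAt.comp_hasDerivWithinAt t h

/-- Smooth dependence on parameters and initial values, for ordinary differential equations
`γ' = X (γ) a` depending linearly on a parameter `a`, for `a` close to `0`. -/
theorem exists_smooth_parametric_flow {E : Type u} [NormedAddCommGroup E] [NormedSpace ℝ E]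
    [FiniteDimensional ℝ E] {P : Type v} [NormedAddCommGroup P] [NormedSpace ℝ P] [CompleteSpace P]
    {X : E → P →L[ℝ] E} {T : Set E} (hT : IsOpen T) (hX : ContDiffOn ℝ ∞ X T)
    {x₀ : E} (hx₀ : x₀ ∈ T) :
    ∃ (N : Set (P × E)) (Ψ : ℝ → P × E → E), IsOpen N ∧ (0, x₀) ∈ N ∧
      (∀ t ∈ Icc (0 : ℝ) 1, ContDiffOn ℝ ∞ (Ψ t) N) ∧
      (∀ t, Ψ t (0, x₀) = x₀) ∧
      (∀ q ∈ N, ∀ t, Ψ t q ∈ T) ∧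
      (∀ q, Continuous fun t => Ψ t q) ∧
      (∀ q ∈ N, Ψ 0 q = q.2) ∧
      (∀ q ∈ N, ∀ t ∈ Ico (0 : ℝ) 1,
        HasDerivWithinAt (fun s => Ψ s q) (X (Ψ t q) q.1) (Ici t) t) ∧
      (∀ q ∈ N, ∀ δ, ContinuousOn (fun s => fderiv ℝ (Ψ s) q δ) (Icc 0 1)) ∧
      (∀ q ∈ N, ∀ δ, fderiv ℝ (Ψ 0) q δ = δ.2) ∧
      (∀ q ∈ N, ∀ δ, ∀ t ∈ Ico (0 : ℝ) 1,
        HasDerivWithinAt (fun s => fderiv ℝ (Ψ s) q δ)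
          (fderiv ℝ X (Ψ t q) (fderiv ℝ (Ψ t) q δ) q.1 + X (Ψ t q) δ.1) (Ici t) t) := by
  have : CompleteSpace E := FiniteDimensional.complete ℝ E
  -- The equation is solved for a global `Y`; for `q` near `(0, x₀)` the solution stays in the set
  -- `S` where `Y` equals `X`.
  obtain ⟨Y, hY, hYX⟩ := hX.exists_contDiff_eventuallyEq (hT.mem_nhds hx₀)
  obtain ⟨S, hS, hSo, hx₀S⟩ := eventually_nhds_iff.1 (hYX.and (hT.mem_nhds hx₀))
  have hdS : ∀ y ∈ S, fderiv ℝ Y y = fderiv ℝ X y := fun y hy =>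
    Filter.EventuallyEq.fderiv_eq (eventually_nhds_iff.2 ⟨S, fun z hz => (hS z hz).1, hSo, hy⟩)
  let Yc : C(E, P →L[ℝ] E) := ⟨Y, hY.continuous⟩
  let Y' : C(E, E →L[ℝ] P →L[ℝ] E) := ⟨fderiv ℝ Y, hY.continuous_fderiv (by simp)⟩
  have hY' : ∀ x, HasFDerivAt Yc (Y' x) x := fun x => (hY.differentiable (by simp) x).hasFDerivAt
  obtain ⟨N₀, ψ, hN₀, hmem, hψ, hψ₀, hfix⟩ := Curve.exists_contDiffOn_fixedPoint Yc hY x₀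
  have hψc : ContinuousAt ψ (0, x₀) := hψ.continuousOn.continuousAt (hN₀.mem_nhds hmem)
  -- curves with values in `S`
  have hev : ∀ᶠ q in 𝓝 ((0 : P), x₀), ∀ t, ψ q t ∈ S := by
    obtain ⟨ε, hε, hball⟩ := Metric.isOpen_iff.1 hSo x₀ hx₀S
    filter_upwards [hψc.eventually (Metric.ball_mem_nhds _ hε)] with q hq t
    apply hball
    rw [hψ₀] at hq
    show dist (ψ q t) x₀ < ε
    rw [dist_eq_norm]
    rw [dist_eq_norm] at hq
    exact ((ψ q - Curve.const x₀).norm_coe_le_norm t).trans_lt hq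
  obtain ⟨N₁, hN₁, hN₁o, hmem₁⟩ := eventually_nhds_iff.1 hev
  have hd : ∀ q ∈ N₀ ∩ N₁, HasFDerivAt ψ (fderiv ℝ ψ q) q := fun q hq =>
    ((hψ.contDiffAt (hN₀.mem_nhds hq.1)).differentiableAt (by simp)).hasFDerivAt
  have hdt : ∀ q ∈ N₀ ∩ N₁, ∀ t δ,
      fderiv ℝ (fun q => (ψ q).extend t) q δ = (fderiv ℝ ψ q δ).extend t := fun q hq t δ => by
    have := ((Curve.eval (E := E) (projIcc 0 1 zero_le_one t)).hasFDerivAt).comp q (hd q hq)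
    exact congrArg (fun L => L δ) this.fderiv
  -- Differentiating the fixed point identity yields the variational equation in integral form.
  have hdfix : ∀ q ∈ N₀ ∩ N₁, ∀ δ, fderiv ℝ ψ q δ = Curve.const δ.2 +
      Curve.primitive (Curve.app (Curve.postcomp Yc (ψ q)) (Curve.const δ.1) +
        Curve.app (Curve.app (Curve.postcomp Y' (ψ q)) (fderiv ℝ ψ q δ)) (Curve.const q.1)) := by
    intro q hq δ
    have h1 : HasFDerivAt (fun q => Curve.integralOperator Yc (q, ψ q)) _ q :=
      HasFDerivAt.comp (f := fun q => (q, ψ q)) q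
        (Curve.hasFDerivAt_integralOperator Yc Y' hY' (q, ψ q))
        ((hasFDerivAt_id q).prodMk (hd q hq))
    have h2 : ψ =ᶠ[𝓝 q] fun q => Curve.integralOperator Yc (q, ψ q) := by
      filter_upwards [hN₀.mem_nhds hq.1] with p hp using hfix p hp
    have h3 := congrArg (fun L => L δ) (h2.fderiv_eq.trans h1.fderiv)
    exact h3
  refine ⟨N₀ ∩ N₁, fun t q => (ψ q).extend t, hN₀.inter hN₁o, ⟨hmem, hmem₁⟩,
    fun t _ => (Curve.eval (E := E) (projIcc 0 1 zero_le_one t)).contDiff.comp_contDiffOn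
      (hψ.mono inter_subset_left), fun t => ?_, fun q hq t => (hS _ (hN₁ q hq.2 _)).2,
    fun q => (ψ q).continuous_extend,
    fun q hq => Curve.extend_zero_of_eq_primitive (hfix q hq.1), fun q hq t ht => ?_,
    fun q hq δ => ?_, fun q hq δ => ?_, fun q hq δ t ht => ?_⟩
  · show (ψ (0, x₀)).extend t = x₀
    rw [hψ₀]; rfl
  · have h := Curve.hasDerivWithinAt_extend_of_eq_primitive (hfix q hq.1) ht
    have hs := (hS _ (hN₁ q hq.2 (projIcc 0 1 zero_le_one t))).1
    show HasDerivWithinAt _ (X (ψ q (projIcc 0 1 zero_le_one t)) q.1) _ _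
    rw [← hs]
    exact h
  · simp only [hdt q hq]
    exact (fderiv ℝ ψ q δ).continuous_extend.continuousOn
  · rw [hdt q hq]
    exact Curve.extend_zero_of_eq_primitive (hdfix q hq δ)
  · simp only [hdt q hq]
    have h := Curve.hasDerivWithinAt_extend_of_eq_primitive (hdfix q hq δ) ht
    have hs := hN₁ q hq.2 (projIcc 0 1 zero_le_one t)
    show HasDerivWithinAt _ (fderiv ℝ X (ψ q (projIcc 0 1 zero_le_one t)) _ _ +
      X (ψ q (projIcc 0 1 zero_le_one t)) _) _ _
    rw [← hdS _ hs, ← (hS _ hs).1, add_comm]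
    exact h

/-- Solutions of `Du = A u`, with values in a Banach algebra, for an `A` subject to the
integrability condition of a flat connection. -/
theorem exists_parallel_section {E : Type u} {R : Type v} [NormedAddCommGroup E] [NormedSpace ℝ E]
    [FiniteDimensional ℝ E] [NormedRing R] [NormedAlgebra ℝ R] [FiniteDimensional ℝ R]
    {A : E → E →L[ℝ] R} {T : Set E} (hT : IsOpen T) (hA : ContDiffOn ℝ ∞ A T)
    (hint : ∀ x ∈ T, ∀ v w, fderiv ℝ A x v w - fderiv ℝ A x w v = A x v * A x w - A x w * A x v)
    {x₀ : E} (hx₀ : x₀ ∈ T) :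
    ∃ (U : Set E) (u : E → R), IsOpen U ∧ U ⊆ T ∧ x₀ ∈ U ∧ ContDiffOn ℝ ∞ u U ∧ u x₀ = 1 ∧
      ∀ x ∈ U, ∀ v, fderiv ℝ u x v = A x v * u x := by
  have : CompleteSpace E := FiniteDimensional.complete ℝ E
  -- The system is `p' = v`, `r' = A p v * r`. Started at `(x₀, 1)` with `v = x - x₀`, its second
  -- component at time 1 is parallel transport along the segment from `x₀` to `x`; this will be `u
  -- x`.
  let X : E × R → E →L[ℝ] E × R := fun z =>
    (ContinuousLinearMap.id ℝ E).prod ((ContinuousLinearMap.mul ℝ R).flip z.2 ∘L A z.1)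
  have hXapp : ∀ z v, X z v = (v, A z.1 v * z.2) := fun z v => rfl
  have hTo : IsOpen (T ×ˢ (univ : Set R)) := hT.prod isOpen_univ
  have hX : ContDiffOn ℝ ∞ X (T ×ˢ univ) := by
    have h1 : ContDiffOn ℝ ∞ (fun z : E × R => A z.1) (T ×ˢ univ) :=
      hA.comp contDiffOn_fst fun z hz => hz.1
    have h2 : ContDiffOn ℝ ∞ (fun z : E × R => (ContinuousLinearMap.mul ℝ R).flip z.2)
      (T ×ˢ univ) := ((ContinuousLinearMap.mul ℝ R).flip.contDiff.comp contDiff_snd).contDiffOn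
    have h3 : ContDiffOn ℝ ∞ (fun z : E × R => ContinuousLinearMap.inl ℝ E R +
        ContinuousLinearMap.inr ℝ E R ∘L ((ContinuousLinearMap.mul ℝ R).flip z.2 ∘L A z.1))
        (T ×ˢ univ) := contDiffOn_const.add (contDiffOn_const.clm_comp (h2.clm_comp h1))
    refine h3.congr fun z _ => ContinuousLinearMap.ext fun v => ?_
    simp [X]
  have hA' : ∀ x ∈ T, HasFDerivAt A (fderiv ℝ A x) x := fun x hx =>
    ((hA.contDiffAt (hT.mem_nhds hx)).differentiableAt (by simp)).hasFDerivAt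
  have hX' : ∀ z ∈ T ×ˢ (univ : Set R), ∀ δ v, fderiv ℝ X z δ v =
      (0, A z.1 v * δ.2 + fderiv ℝ A z.1 δ.1 v * z.2) := fun z hz δ v => by
    have h1 := ((hX.contDiffAt (hTo.mem_nhds hz)).differentiableAt (by simp)).hasFDerivAt.clm_apply
      (hasFDerivAt_const v z)
    have h2 : HasFDerivAt (fun z : E × R => A z.1 v) _ z :=
      ((hA' z.1 hz.1).comp z hasFDerivAt_fst).clm_apply (hasFDerivAt_const v z)
    have h3 := (hasFDerivAt_const v z).prodMk (h2.mul' (hasFDerivAt_snd (𝕜 := ℝ) (p := z)))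
    have h4 := congrArg (fun L => L δ) (h1.unique h3)
    simpa using h4
  obtain ⟨N, Ψ, hNo, hN0, hΨs, hΨ0, hΨT, hΨc, hΨi, hΨd, hDc, hDi, hDd⟩ :=
    exists_smooth_parametric_flow hTo hX (x₀ := (x₀, 1)) ⟨hx₀, mem_univ _⟩
  let ι : E → E × (E × R) := fun x => (x - x₀, (x₀, 1))
  have hι : ContDiff ℝ ∞ ι := (contDiff_id.sub contDiff_const).prodMk contDiff_const
  have hι0 : ι x₀ = (0, (x₀, 1)) := by simp [ι]
  -- the first component of the solution is a segment
  have hseg : ∀ x, ι x ∈ N → ∀ t ∈ Icc (0 : ℝ) 1, (Ψ t (ι x)).1 = x₀ + t • (x - x₀) := by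
    intro x hx t ht
    have hd : ∀ s ∈ Ico (0 : ℝ) 1, HasDerivWithinAt
        (fun s => (Ψ s (ι x)).1 - s • (x - x₀)) 0 (Ici s) s := fun s hs => by
      have h1 := (hΨd _ hx s hs).fst'
      have h2 := h1.sub ((hasDerivAt_id s).smul_const (x - x₀)).hasDerivWithinAt
      exact h2.congr_deriv (by simp [hXapp, ι])
    have h : (Ψ t (ι x)).1 - t • (x - x₀) = (Ψ 0 (ι x)).1 - (0 : ℝ) • (x - x₀) :=
      constant_of_has_deriv_right_zero
      (((hΨc (ι x)).fst.sub (continuous_id.smul continuous_const)).continuousOn) hd t ht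
    rw [hΨi _ hx, zero_smul, sub_zero] at h
    exact sub_eq_iff_eq_add.1 h
  have hsegD : ∀ x, ι x ∈ N → ∀ w, ∀ t ∈ Icc (0 : ℝ) 1,
      (fderiv ℝ (Ψ t) (ι x) (w, 0)).1 = t • w := by
    intro x hx w t ht
    have hd : ∀ s ∈ Ico (0 : ℝ) 1, HasDerivWithinAt
        (fun s => (fderiv ℝ (Ψ s) (ι x) (w, 0)).1 - s • w) 0 (Ici s) s := fun s hs => by
      have h1 := (hDd _ hx (w, 0) s hs).fst'
      have h2 := h1.sub ((hasDerivAt_id s).smul_const w).hasDerivWithinAt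
      exact h2.congr_deriv (by simp [hXapp, hX' _ (hΨT _ hx s)])
    have h : (fderiv ℝ (Ψ t) (ι x) (w, 0)).1 - t • w =
        (fderiv ℝ (Ψ 0) (ι x) (w, 0)).1 - (0 : ℝ) • w := constant_of_has_deriv_right_zero
      (((hDc _ hx (w, 0)).fst.sub (continuous_id.smul continuous_const).continuousOn)) hd t ht
    rw [hDi _ hx, zero_smul, sub_zero] at h
    exact sub_eq_zero.1 h
  have hsol : ∀ x, ι x ∈ N → ∀ w, (fderiv ℝ (Ψ 1) (ι x) (w, 0)).2 = A x w * (Ψ 1 (ι x)).2 := by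
    intro x hx w
    set v := x - x₀
    set p : ℝ → E := fun t => (Ψ t (ι x)).1
    set r : ℝ → R := fun t => (Ψ t (ι x)).2
    set h : ℝ → R := fun t => (fderiv ℝ (Ψ t) (ι x) (w, 0)).2
    have hpT : ∀ t, p t ∈ T := fun t => (hΨT _ hx t).1
    have hpc : Continuous p := (hΨc (ι x)).fst
    have hrc : Continuous r := (hΨc (ι x)).snd
    have hAc : Continuous fun t => A (p t) := hA.continuousOn.comp_continuous hpc hpT
    obtain ⟨C, hC⟩ := isCompact_Icc.exists_bound_of_continuousOn (s := Icc (0 : ℝ) 1)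
      (f := fun t => A (p t) v) (hAc.clm_apply continuous_const).continuousOn
    -- The variation `h` in direction `w` is compared with its expected value `A (p t) (t • w) * r
    -- t`. By the integrability condition the difference solves a homogeneous linear equation, and
    -- it vanishes at 0, hence (Grönwall) also at 1.
    have key := eq_zero_of_abs_deriv_le_mul_abs_self_of_eq_zero_right (a := 0) (b := 1) (K := C)
      (f := fun t => h t - A (p t) (t • w) * r t)
      (f' := fun t => A (p t) v * (h t - A (p t) (t • w) * r t)) ?_ ?_ ?_ ?_ 1
      (right_mem_Icc.2 zero_le_one)
    · have hp1 : p 1 = x := by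
        simp only [p, hseg x hx 1 (right_mem_Icc.2 zero_le_one), one_smul, add_sub_cancel]
      simp only [one_smul, hp1] at key
      exact sub_eq_zero.1 key
    · exact (hDc _ hx (w, 0)).snd.sub ((hAc.clm_apply
        (continuous_id.smul continuous_const)).mul hrc).continuousOn
    · intro s hs
      have hsI := Ico_subset_Icc_self hs
      have hp' := (hΨd _ hx s hs).fst'
      have hr' := (hΨd _ hx s hs).snd'
      have hh' := (hDd _ hx (w, 0) s hs).snd'
      have hAp := (hA' _ (hpT s)).comp_hasDerivWithinAt s hp'
      have hk := ((hAp.clm_apply ((hasDerivAt_id s).smul_const w).hasDerivWithinAt).mul hr')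
      refine (hh'.sub hk).congr_deriv ?_
      have hi := hint _ (hpT s) (s • w) v
      have hi' : fderiv ℝ A (p s) (s • w) v = fderiv ℝ A (p s) v (s • w) +
        (A (p s) (s • w) * A (p s) v - A (p s) v * A (p s) (s • w)) := by rw [← hi]; abel
      simp only [hX' _ (hΨT _ hx s), hsegD x hx w s hsI, hXapp, id]
      show A (p s) v * h s + fderiv ℝ A (p s) (s • w) v * r s + A (p s) w * r s -
        ((fderiv ℝ A (p s) v (s • w) + A (p s) ((1 : ℝ) • w)) * r s +
          A (p s) (s • w) * (A (p s) v * r s)) = _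
      rw [hi', one_smul]
      noncomm_ring
    · simp [h, hDi _ hx]
    · intro s hs
      exact (norm_mul_le _ _).trans
        (mul_le_mul_of_nonneg_right (hC s (Ico_subset_Icc_self hs)) (norm_nonneg _))
  refine ⟨ι ⁻¹' N, fun x => (Ψ 1 (ι x)).2, hNo.preimage hι.continuous, fun x hx => ?_, ?_, ?_, ?_,
    fun x hx w => ?_⟩
  · have h1 := (hΨT _ hx 1).1
    rw [hseg x hx 1 (right_mem_Icc.2 zero_le_one)] at h1
    simpa using h1
  · rwa [mem_preimage, hι0]
  · exact contDiff_snd.comp_contDiffOn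
      ((hΨs 1 (right_mem_Icc.2 zero_le_one)).comp hι.contDiffOn fun _ h => h)
  · show (Ψ 1 (ι x₀)).2 = 1
    rw [hι0, hΨ0]
  · have hd1 : HasFDerivAt (Ψ 1) (fderiv ℝ (Ψ 1) (ι x)) (ι x) :=
      (((hΨs 1 (right_mem_Icc.2 zero_le_one)).contDiffAt (hNo.mem_nhds hx)).differentiableAt
        (by simp)).hasFDerivAt
    have hd2 : HasFDerivAt ι ((ContinuousLinearMap.id ℝ E).prod 0) x :=
      ((hasFDerivAt_id x).sub_const x₀).prodMk (hasFDerivAt_const _ x)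
    have h := congrArg (fun L => L w) (hd1.comp x hd2).snd.fderiv
    rw [← hsol x hx w]
    exact h

end

/-! ### Complex frames and the Maurer-Cartan equation -/

noncomputable section

open scoped Topology
open Set Filter

theorem two_le_infty : (2 : WithTop ℕ∞) ≤ ∞ :=
  WithTop.coe_le_coe.2 (le_top : (2 : ℕ∞) ≤ ⊤)

section LocalFrame

open VectorField Complex

variable {E : Type*} [NormedAddCommGroup E] [NormedSpace ℝ E]

/-- A family of complex vector fields on an open subset `T` of `E`, parametrized complex-linearly by
`F`, which trivializes the complexified tangent bundle of `T` and is closed under the Lie bracket.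
The field with parameter `z` has real part `re · z` and imaginary part `-re · (I • z)`. -/
structure ComplexFrame (T : Set E) (F : Type*) [NormedAddCommGroup F] [NormedSpace ℂ F] where
  /-- The real parts of the fields. -/
  re : E → F →L[ℝ] E
  /-- The structure constants. -/
  bracket : F →L[ℝ] F →L[ℝ] F
  isOpen : IsOpen T
  contDiffOn : ContDiffOn ℝ ∞ re T
  bijective : ∀ p ∈ T, Function.Bijective fun z => (re p z, re p (I • z))
  bracket_I_left : ∀ y z, bracket (I • y) z = I • bracket y z
  bracket_I_right : ∀ y z, bracket y (I • z) = I • bracket y z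
  re_bracket : ∀ p ∈ T, ∀ y z, re p (bracket y z) =
    lieBracket ℝ (fun q => re q y) (fun q => re q z) p -
      lieBracket ℝ (fun q => re q (I • y)) (fun q => re q (I • z)) p

namespace ComplexFrame

variable {F : Type*} [NormedAddCommGroup F] [NormedSpace ℂ F] {T : Set E} (e : ComplexFrame T F)

theorem hasFDerivAt_re {p : E} (hp : p ∈ T) : HasFDerivAt e.re (fderiv ℝ e.re p) p :=
  ((e.contDiffOn.contDiffAt (e.isOpen.mem_nhds hp)).differentiableAt (by simp)).hasFDerivAt

theorem fderiv_re_apply {p : E} (hp : p ∈ T) (v : E) (z : F) :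
    fderiv ℝ (fun q => e.re q z) p v = fderiv ℝ e.re p v z := by
  have h := (e.hasFDerivAt_re hp).clm_apply (hasFDerivAt_const z p)
  simpa using congrArg (fun L => L v) h.fderiv

theorem contDiffOn_re_apply (z : F) : ContDiffOn ℝ ∞ (fun q => e.re q z) T :=
  e.contDiffOn.clm_apply contDiffOn_const

theorem contDiffAt_re_apply {p : E} (hp : p ∈ T) (z : F) : ContDiffAt ℝ ∞ (fun q => e.re q z) p :=
  (e.contDiffOn_re_apply z).contDiffAt (e.isOpen.mem_nhds hp)

/-- Up to sign this is the imaginary part of the bracket relation; it follows from the real part by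
complex linearity in the second argument. -/
theorem re_bracket_I {p : E} (hp : p ∈ T) (y z : F) : e.re p (I • e.bracket y z) =
    lieBracket ℝ (fun q => e.re q y) (fun q => e.re q (I • z)) p +
      lieBracket ℝ (fun q => e.re q (I • y)) (fun q => e.re q z) p := by
  rw [← e.bracket_I_right, e.re_bracket p hp, smul_smul, I_mul_I]
  simp only [neg_smul, one_smul, map_neg, lieBracket_eq, fderiv_fun_neg,
    neg_apply]
  abel

theorem ext_re {p : E} (hp : p ∈ T) {y z : F} (h : e.re p y = e.re p z)
    (h' : e.re p (I • y) = e.re p (I • z)) : y = z :=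
  (e.bijective p hp).1 (Prod.ext h h')

theorem bracket_swap {p : E} (hp : p ∈ T) (y z : F) : e.bracket y z = - e.bracket z y := by
  apply e.ext_re hp
  · rw [map_neg, e.re_bracket p hp, e.re_bracket p hp, lieBracket_swap,
      lieBracket_swap (V := fun q => e.re q (I • y))]
    abel
  · rw [smul_neg, map_neg, e.re_bracket_I hp, e.re_bracket_I hp, lieBracket_swap,
      lieBracket_swap (V := fun q => e.re q (I • y))]
    abel

theorem re_bracket_bracket {p : E} (hp : p ∈ T) (x y z : F) :
    e.re p (e.bracket x (e.bracket y z)) =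
    lieBracket ℝ (fun q => e.re q x) (lieBracket ℝ (fun q => e.re q y) (fun q => e.re q z)) p -
    lieBracket ℝ (fun q => e.re q x)
      (lieBracket ℝ (fun q => e.re q (I • y)) (fun q => e.re q (I • z))) p -
    lieBracket ℝ (fun q => e.re q (I • x))
      (lieBracket ℝ (fun q => e.re q y) (fun q => e.re q (I • z))) p -
    lieBracket ℝ (fun q => e.re q (I • x))
      (lieBracket ℝ (fun q => e.re q (I • y)) (fun q => e.re q z)) p := by
  have hd : ∀ y z, DifferentiableAt ℝ (lieBracket ℝ (fun q => e.re q y) (fun q => e.re q z)) p :=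
    fun y z => (ContDiffAt.lieBracket_vectorField (m := 1) (n := ∞) (e.contDiffAt_re_apply hp y)
      (e.contDiffAt_re_apply hp z)
      (by rw [one_add_one_eq_two]; exact two_le_infty)).differentiableAt (by simp)
  have h1 : (fun q => e.re q (e.bracket y z)) =ᶠ[𝓝 p]
      lieBracket ℝ (fun q => e.re q y) (fun q => e.re q z) +
      (-1 : ℝ) • lieBracket ℝ (fun q => e.re q (I • y)) (fun q => e.re q (I • z)) := by
    filter_upwards [e.isOpen.mem_nhds hp] with q hq
    simp [e.re_bracket q hq, sub_eq_add_neg]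
  have h2 : (fun q => e.re q (I • e.bracket y z)) =ᶠ[𝓝 p]
      lieBracket ℝ (fun q => e.re q y) (fun q => e.re q (I • z)) +
      lieBracket ℝ (fun q => e.re q (I • y)) (fun q => e.re q z) := by
    filter_upwards [e.isOpen.mem_nhds hp] with q hq
    simp [e.re_bracket_I hq]
  rw [e.re_bracket p hp, EventuallyEq.rfl.lieBracket_vectorField_eq h1,
    EventuallyEq.rfl.lieBracket_vectorField_eq h2, lieBracket_add_right (hd _ _)
    ((hd _ _).const_smul _), lieBracket_add_right (hd _ _) (hd _ _),
    lieBracket_const_smul_right (hd _ _)]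
  module

/-- The Jacobi identity of real vector fields, applied to each of the four iterated brackets in
`re_bracket_bracket`. -/
theorem re_jacobi {p : E} (hp : p ∈ T) (x y z : F) : e.re p (e.bracket x (e.bracket y z)) =
    e.re p (e.bracket y (e.bracket x z)) - e.re p (e.bracket z (e.bracket x y)) := by
  have hl : ∀ x y z,
      lieBracket ℝ (fun q => e.re q x) (lieBracket ℝ (fun q => e.re q y) (fun q => e.re q z)) p =
      lieBracket ℝ (fun q => e.re q y) (lieBracket ℝ (fun q => e.re q x) (fun q => e.re q z)) p -
      lieBracket ℝ (fun q => e.re q z)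
        (lieBracket ℝ (fun q => e.re q x) (fun q => e.re q y)) p := fun x y z => by
    rw [leibniz_identity_lieBracket (n := ∞) (by simpa using two_le_infty)
      (e.contDiffAt_re_apply hp x) (e.contDiffAt_re_apply hp y) (e.contDiffAt_re_apply hp z),
      lieBracket_swap
      (V := lieBracket ℝ (fun q => e.re q x) (fun q => e.re q y))]
    abel
  rw [e.re_bracket_bracket hp, e.re_bracket_bracket hp, e.re_bracket_bracket hp, hl x y z,
    hl x (I • y) (I • z), hl (I • x) y (I • z), hl (I • x) (I • y) z]
  abel

/-- A parameter is determined by the real parts of itself and of its multiple by `I` at a single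
point; the second real part is handled by `re_jacobi` with `I • x` in place of `x`. -/
theorem jacobi {p : E} (hp : p ∈ T) (x y z : F) : e.bracket (e.bracket x y) z =
    e.bracket x (e.bracket y z) - e.bracket y (e.bracket x z) := by
  rw [e.bracket_swap hp (e.bracket x y), neg_eq_iff_eq_neg, neg_sub]
  apply e.ext_re hp
  · rw [map_sub, e.re_jacobi hp x y z, sub_sub_cancel]
  · rw [smul_sub, map_sub]
    have h := e.re_jacobi hp (I • x) y z
    simp only [e.bracket_I_left, e.bracket_I_right] at h
    rw [h, sub_sub_cancel]

/-- Multiplication by the imaginary unit. -/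
def mulI : F →L[ℝ] F := (I • ContinuousLinearMap.id ℂ F).restrictScalars ℝ

@[simp] theorem mulI_apply (z : F) : mulI z = I • z := rfl

/-- The real-linear isomorphism from the parameter space onto the complexified tangent space at `p`,
viewed as `E × E`. -/
def reIm (p : E) : F →L[ℝ] E × E :=
  (e.re p).prod (e.re p ∘L mulI)

@[simp] theorem reIm_apply (p : E) (z : F) : e.reIm p z = (e.re p z, e.re p (I • z)) := rfl

/-- The Maurer-Cartan form of a frame: `e.form p v` is the parameter of the field of the frame whose
value at `p` is the real vector `v`. -/
def form (p : E) : E →L[ℝ] F := (e.reIm p).inverse ∘L ContinuousLinearMap.inl ℝ E E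

variable [FiniteDimensional ℂ F]

theorem isInvertible_reIm {p : E} (hp : p ∈ T) : (e.reIm p).IsInvertible := by
  have : FiniteDimensional ℝ F := FiniteDimensional.complexToReal F
  exact ⟨(LinearEquiv.ofBijective (e.reIm p : F →ₗ[ℝ] E × E)
    (e.bijective p hp)).toContinuousLinearEquiv, rfl⟩

theorem contDiffOn_form : ContDiffOn ℝ ∞ e.form T := by
  have : FiniteDimensional ℝ F := FiniteDimensional.complexToReal F
  have : CompleteSpace F := FiniteDimensional.complete ℝ F
  intro p hp
  obtain ⟨L, hL⟩ := e.isInvertible_reIm hp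
  have h0 := e.contDiffOn.contDiffAt (e.isOpen.mem_nhds hp)
  have h1 : ContDiffAt ℝ ∞ e.reIm p :=
    (h0.continuousLinearMap_comp (ContinuousLinearMap.compL ℝ F E (E × E) (.inl ℝ E E))).add
      ((h0.clm_comp (contDiffAt_const (c := mulI))).continuousLinearMap_comp
        (ContinuousLinearMap.compL ℝ F E (E × E) (.inr ℝ E E))) |>.congr_of_eventuallyEq
      (Eventually.of_forall fun q => ContinuousLinearMap.ext fun z => by simp)
  have h2 : ContDiffAt ℝ ∞ ContinuousLinearMap.inverse (e.reIm p) := by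
    rw [← hL]
    exact contDiffAt_map_inverse L
  exact ((h2.comp p h1).clm_comp contDiffAt_const).contDiffWithinAt

theorem hasFDerivAt_form {p : E} (hp : p ∈ T) : HasFDerivAt e.form (fderiv ℝ e.form p) p :=
  ((e.contDiffOn_form.contDiffAt (e.isOpen.mem_nhds hp)).differentiableAt (by simp)).hasFDerivAt

theorem reIm_form {p : E} (hp : p ∈ T) (v : E) : e.reIm p (e.form p v) = (v, 0) := by
  obtain ⟨L, hL⟩ := e.isInvertible_reIm hp
  simp only [form, ← hL, ContinuousLinearMap.inverse_equiv]
  simp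

@[simp] theorem re_form {p : E} (hp : p ∈ T) (v : E) : e.re p (e.form p v) = v :=
  congrArg Prod.fst (e.reIm_form hp v)

@[simp] theorem re_I_form {p : E} (hp : p ∈ T) (v : E) : e.re p (I • e.form p v) = 0 :=
  congrArg Prod.snd (e.reIm_form hp v)

/-- The field with parameter `z` has value `re z - i re (I • z)`, and the complex-linear extension
of `form` inverts evaluation at `p`. -/
theorem form_re {p : E} (hp : p ∈ T) (z : F) :
    e.form p (e.re p z) - I • e.form p (e.re p (I • z)) = z := by
  apply e.ext_re hp
  · simp [hp]
  · rw [smul_sub, smul_smul, I_mul_I]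
    simp [hp]

/-- Differentiation of the relation between the frame and its form. -/
theorem fderiv_form_re {p : E} (hp : p ∈ T) (v : E) (z : F) :
    fderiv ℝ e.form p v (e.re p z) + e.form p (fderiv ℝ e.re p v z) -
      I • (fderiv ℝ e.form p v (e.re p (I • z)) +
        e.form p (fderiv ℝ e.re p v (I • z))) = 0 := by
  have hz : ∀ z : F, HasFDerivAt (fun q => e.re q z) ((fderiv ℝ e.re p).flip z) p := fun z => by
    have h := (e.hasFDerivAt_re hp).clm_apply (hasFDerivAt_const z p)
    simpa using h
  have h1 : HasFDerivAt (fun q => e.form q (e.re q z) - I • e.form q (e.re q (I • z))) _ p :=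
    ((e.hasFDerivAt_form hp).clm_apply (hz z)).sub
      (((e.hasFDerivAt_form hp).clm_apply (hz (I • z))).const_smul I)
  have h2 : (fun q => e.form q (e.re q z) - I • e.form q (e.re q (I • z))) =ᶠ[𝓝 p] fun _ => z := by
    filter_upwards [e.isOpen.mem_nhds hp] with q hq using e.form_re hq z
  have h3 := congrArg (fun L => L v) (h1.unique (h2.hasFDerivAt_iff.2 (hasFDerivAt_const z p)))
  simpa [add_comm] using h3

/-- The Maurer-Cartan equation. -/
theorem maurerCartan {p : E} (hp : p ∈ T) (v w : E) :
    fderiv ℝ e.form p v w - fderiv ℝ e.form p w v = - e.bracket (e.form p v) (e.form p w) := by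
  -- The fields with constant parameters `form p v` and `form p w` have the real values `v` and `w`
  -- at `p`, so all terms containing the values of their imaginary parts at `p` drop out.
  have h1 := e.fderiv_form_re hp v (e.form p w)
  have h2 := e.fderiv_form_re hp w (e.form p v)
  have h3 := e.form_re hp (e.bracket (e.form p v) (e.form p w))
  rw [e.re_bracket p hp, e.re_bracket_I hp] at h3
  simp only [lieBracket_eq, e.fderiv_re_apply hp, e.re_form hp, e.re_I_form hp, map_zero,
    sub_zero, zero_sub, zero_add, zero_apply, map_sub, map_neg, map_add] at h1 h2 h3
  rw [← h3]
  linear_combination (norm := module) h1 - h2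

end ComplexFrame

end LocalFrame

end

/-! ### Local isometries and Killing fields obtained from a frame -/

noncomputable section

open scoped Topology
open Set Filter

section LocalIsometries

variable {E F H P : Type*} [NormedAddCommGroup E] [NormedSpace ℝ E]
  [NormedAddCommGroup F] [NormedSpace ℝ F] [NormedAddCommGroup H] [NormedSpace ℝ H]
  [NormedAddCommGroup P] [NormedSpace ℝ P]

/-- The Lie derivative `L_X θ` of a vector-valued one-form. -/
def lieForm (θ : E → E →L[ℝ] F) (X : E → E) (p v : E) : F :=
  fderiv ℝ θ p (X p) v + θ p (fderiv ℝ X p v)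

/-- If the infinitesimal isometries in a family are sufficiently many, then nearby points are
related by local isometries. The metric is `h (θ ·) (θ ·)`. -/
theorem eventually_exists_local_isometry [FiniteDimensional ℝ E] [CompleteSpace P]
    {U : Set E} (hU : IsOpen U) {X : E → P →L[ℝ] E} (hX : ContDiffOn ℝ ∞ X U)
    {θ : E → E →L[ℝ] F} (hθ : DifferentiableOn ℝ θ U) (h : F →L[ℝ] F →L[ℝ] H)
    (hK : ∀ p ∈ U, ∀ a v w, h (lieForm θ (fun q => X q a) p v) (θ p w) +
      h (θ p v) (lieForm θ (fun q => X q a) p w) = 0)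
    {p₀ : E} (hp₀ : p₀ ∈ U) (hsurj : (X p₀).range = ⊤) :
    ∀ᶠ q in 𝓝 p₀, ∃ φ : OpenPartialHomeomorph E E, p₀ ∈ φ.source ∧ φ p₀ = q ∧
      φ.source ⊆ U ∧ φ.target ⊆ U ∧ ContDiffOn ℝ ∞ φ φ.source ∧
      ContDiffOn ℝ ∞ φ.symm φ.target ∧ ∀ p ∈ φ.source, ∀ v w,
        h (θ (φ p) (fderiv ℝ φ p v)) (θ (φ p) (fderiv ℝ φ p w)) = h (θ p v) (θ p w) := by
  have : CompleteSpace E := FiniteDimensional.complete ℝ E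
  obtain ⟨N, Ψ, hNo, hN0, hΨs, hΨ0, hΨT, hΨc, hΨi, hΨd, hDc, hDi, hDd⟩ :=
    exists_smooth_parametric_flow hU hX hp₀
  have h1mem : (1 : ℝ) ∈ Icc (0 : ℝ) 1 := right_mem_Icc.2 zero_le_one
  have hs1 := hΨs 1 h1mem
  have hd1 : ∀ q ∈ N, HasFDerivAt (Ψ 1) (fderiv ℝ (Ψ 1) q) q := fun q hq =>
    ((hs1.contDiffAt (hNo.mem_nhds hq)).differentiableAt (by simp)).hasFDerivAt
  have hX' : ∀ p ∈ U, ∀ a v, fderiv ℝ (fun q => X q a) p v = fderiv ℝ X p v a :=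
    fun p hp a v => by
      have h := ((hX.contDiffAt (hU.mem_nhds hp)).differentiableAt
        (by simp)).hasFDerivAt.clm_apply (hasFDerivAt_const a p)
      simpa using congrArg (fun L => L v) h.fderiv
  have hθ' : ∀ p ∈ U, HasFDerivAt θ (fderiv ℝ θ p) p := fun p hp =>
    ((hθ p hp).differentiableAt (hU.mem_nhds hp)).hasFDerivAt
  -- the derivative of the flow at the base point
  have hD0 : ∀ δ, fderiv ℝ (Ψ 1) (0, p₀) δ = δ.2 + X p₀ δ.1 := by
    intro δ
    have hd : ∀ s ∈ Ico (0 : ℝ) 1, HasDerivWithinAt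
        (fun s => fderiv ℝ (Ψ s) (0, p₀) δ - s • X p₀ δ.1) 0 (Ici s) s := fun s hs => by
      have h2 := (hDd _ hN0 δ s hs).sub ((hasDerivAt_id s).smul_const (X p₀ δ.1)).hasDerivWithinAt
      exact h2.congr_deriv (by simp [hΨ0])
    have h3 : fderiv ℝ (Ψ 1) (0, p₀) δ - (1 : ℝ) • X p₀ δ.1 =
        fderiv ℝ (Ψ 0) (0, p₀) δ - (0 : ℝ) • X p₀ δ.1 := constant_of_has_deriv_right_zero
      ((hDc _ hN0 δ).sub (continuous_id.smul continuous_const).continuousOn) hd 1 h1mem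
    rw [hDi _ hN0, one_smul, zero_smul, sub_zero] at h3
    exact sub_eq_iff_eq_add.1 h3
  -- the flow acts by isometries
  have hiso : ∀ q ∈ N, ∀ v w, h (θ (Ψ 1 q) (fderiv ℝ (Ψ 1) q (0, v)))
      (θ (Ψ 1 q) (fderiv ℝ (Ψ 1) q (0, w))) = h (θ q.2 v) (θ q.2 w) := by
    intro q hq v w
    have hθc : Continuous fun s => θ (Ψ s q) :=
      hθ.continuousOn.comp_continuous (hΨc q) (hΨT q hq)
    have hc : ∀ v, ContinuousOn (fun s => θ (Ψ s q) (fderiv ℝ (Ψ s) q (0, v))) (Icc 0 1) :=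
      fun v => hθc.continuousOn.clm_apply (hDc q hq (0, v))
    -- The time derivative of the form pulled back by the flow is the pullback of its Lie
    -- derivative.
    have hd : ∀ v, ∀ s ∈ Ico (0 : ℝ) 1,
        HasDerivWithinAt (fun s => θ (Ψ s q) (fderiv ℝ (Ψ s) q (0, v)))
          (lieForm θ (fun p => X p q.1) (Ψ s q) (fderiv ℝ (Ψ s) q (0, v))) (Ici s) s := by
      intro v s hs
      have h1 := (hθ' _ (hΨT q hq s)).comp_hasDerivWithinAt s (hΨd q hq s hs)
      refine (h1.clm_apply (hDd q hq (0, v) s hs)).congr_deriv ?_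
      simp [lieForm, hX' _ (hΨT q hq s)]
    have h3 : h (θ (Ψ 1 q) (fderiv ℝ (Ψ 1) q (0, v))) (θ (Ψ 1 q) (fderiv ℝ (Ψ 1) q (0, w))) =
        h (θ (Ψ 0 q) (fderiv ℝ (Ψ 0) q (0, v))) (θ (Ψ 0 q) (fderiv ℝ (Ψ 0) q (0, w))) :=
      constant_of_has_deriv_right_zero
        ((h.continuous.comp_continuousOn (hc v)).clm_apply (hc w)) (fun s hs => by
          have h1 := h.hasFDerivAt.comp_hasDerivWithinAt s (hd v s hs)
          exact (h1.clm_apply (hd w s hs)).congr_deriv (hK _ (hΨT q hq s) _ _ _)) 1 h1mem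
    rw [h3, hDi q hq, hDi q hq, hΨi q hq]
  -- the orbit map is open at `0`
  have hι : HasStrictFDerivAt (fun a : P => (a, p₀)) (ContinuousLinearMap.inl ℝ P E) 0 :=
    (hasStrictFDerivAt_id _).prodMk (hasStrictFDerivAt_const _ _)
  have horb : HasStrictFDerivAt (fun a : P => Ψ 1 (a, p₀)) (X p₀) 0 := by
    have h1 := ((hs1.contDiffAt (hNo.mem_nhds hN0)).hasStrictFDerivAt (by simp)).comp
      (f := fun a : P => (a, p₀)) 0 hι
    refine h1.congr_fderiv (ContinuousLinearMap.ext fun a => ?_)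
    simp [hD0]
  have hmap := horb.map_nhds_eq_of_surj hsurj
  rw [hΨ0] at hmap
  rw [← hmap, eventually_map]
  have hev1 : ∀ᶠ a in 𝓝 (0 : P), (a, p₀) ∈ N :=
    hι.continuousAt.eventually (hNo.mem_nhds hN0)
  -- At `a = 0` this derivative is the identity, so for small `a` the time-one map is still a local
  -- diffeomorphism at `p₀`.
  have hev2 : ∀ᶠ a in 𝓝 (0 : P), fderiv ℝ (Ψ 1) (a, p₀) ∘L ContinuousLinearMap.inr ℝ P E ∈
      range ((↑) : (E ≃L[ℝ] E) → E →L[ℝ] E) := by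
    have h1 : ContinuousAt (fun a : P => fderiv ℝ (Ψ 1) (a, p₀) ∘L
        ContinuousLinearMap.inr ℝ P E) 0 :=
      (((hs1.continuousOn_fderiv_of_isOpen hNo (by simp)).continuousAt
        (hNo.mem_nhds hN0)).comp (f := fun a : P => (a, p₀)) hι.continuousAt).clm_comp
        continuousAt_const
    refine h1.eventually
      (ContinuousLinearEquiv.isOpen.mem_nhds ⟨ContinuousLinearEquiv.refl ℝ E, ?_⟩)
    ext v
    simp [hD0]
  filter_upwards [hev1, hev2] with a ha1 ha2
  obtain ⟨L, hL⟩ := ha2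
  let j : E → P × E := fun x => (a, x)
  have hj : ContDiff ℝ ∞ j := contDiff_const.prodMk contDiff_id
  have hj' : ∀ x, HasFDerivAt j (ContinuousLinearMap.inr ℝ P E) x := fun x =>
    (hasFDerivAt_const _ _).prodMk (hasFDerivAt_id _)
  have hφs : ContDiffOn ℝ ∞ (fun x => Ψ 1 (j x)) (j ⁻¹' N) :=
    hs1.comp hj.contDiffOn fun _ hx => hx
  have hφ' : ∀ x, j x ∈ N → HasFDerivAt (fun x => Ψ 1 (j x))
      (fderiv ℝ (Ψ 1) (j x) ∘L ContinuousLinearMap.inr ℝ P E) x := fun x hx =>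
    (hd1 _ hx).comp x (hj' x)
  obtain ⟨φ, hmem, hsub, hφ, hsymm⟩ := hφs.exists_openPartialHomeomorph
    (hNo.preimage hj.continuous) ha1 (f' := L) (by rw [hL]; exact hφ' p₀ ha1)
  have hmaps : ∀ x, j x ∈ N → Ψ 1 (j x) ∈ U := fun x hx => hΨT _ hx 1
  refine ⟨φ, hmem, by rw [hφ], fun x hx => ?_, fun y hy => ?_, ?_, hsymm, fun p hp v w => ?_⟩
  · have h1 := hΨT _ (hsub hx) 0
    rwa [hΨi _ (hsub hx)] at h1
  · have h1 := hmaps _ (hsub (φ.map_target hy))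
    rw [← φ.right_inv hy, hφ]
    exact h1
  · rw [hφ]
    exact hφs.mono hsub
  · rw [hφ, (hφ' p (hsub hp)).fderiv]
    exact hiso _ (hsub hp) v w

end LocalIsometries

namespace ComplexFrame

open Complex VectorField

variable {E : Type*} [NormedAddCommGroup E] [NormedSpace ℝ E] {F : Type*} [NormedAddCommGroup F]
  [NormedSpace ℂ F] [FiniteDimensional ℂ F] {T : Set E} (e : ComplexFrame T F)

/-- A complex vector field commuting with the frame preserves the form of the frame. -/
theorem lieForm_add_I_smul_lieForm {p : E} (hp : p ∈ T) {f : E → F} {f' : E →L[ℝ] F}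
    (hf : HasFDerivAt f f' p) (hf' : ∀ v, f' v = - e.bracket (e.form p v) (f p)) (v : E) :
    lieForm e.form (fun q => e.re q (f q)) p v +
      I • lieForm e.form (fun q => -e.re q (I • f q)) p v = 0 := by
  have hIf : HasFDerivAt (fun q => I • f q) (mulI ∘L f') p := (mulI (F := F)).hasFDerivAt.comp p hf
  have h1 := (e.hasFDerivAt_re hp).clm_apply hf
  have h2 : HasFDerivAt (fun q => -e.re q (I • f q)) _ p :=
    ((e.hasFDerivAt_re hp).clm_apply hIf).neg
  have h3 : HasFDerivAt (fun q => e.form q (e.re q (f q)) +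
      I • e.form q (-e.re q (I • f q))) _ p :=
    ((e.hasFDerivAt_form hp).clm_apply h1).add
      (((e.hasFDerivAt_form hp).clm_apply h2).const_smul I)
  have hrel : ∀ q ∈ T, e.form q (e.re q (f q)) + I • e.form q (-e.re q (I • f q)) = f q :=
    fun q hq => by
      rw [map_neg, smul_neg, ← sub_eq_add_neg]
      exact e.form_re hq (f q)
  have h4 : (fun q => e.form q (e.re q (f q)) + I • e.form q (-e.re q (I • f q))) =ᶠ[𝓝 p] f := by
    filter_upwards [e.isOpen.mem_nhds hp] with q hq using hrel q hq
  have h5 := congrArg (fun L => L v) (h3.unique (h4.hasFDerivAt_iff.2 hf))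
  -- Maurer-Cartan is used for the real and the imaginary part of the field separately; `m3`
  -- recombines the two brackets into the bracket with `f p`.
  have m1 := e.maurerCartan hp v (e.re p (f p))
  have m2 := e.maurerCartan hp v (-e.re p (I • f p))
  have m3 := congrArg (e.bracket (e.form p v)) (hrel p hp)
  rw [map_add, e.bracket_I_right] at m3
  rw [lieForm, lieForm, HasFDerivAt.fderiv h1, HasFDerivAt.fderiv h2]
  simp only [hf', add_apply, smul_apply, ContinuousLinearMap.comp_apply,
    ContinuousLinearMap.flip_apply, neg_apply] at h5 ⊢
  linear_combination (norm := module) h5 - m1 - I • m2 + m3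

section Metric

variable (h : F →L[ℝ] F →L[ℝ] ℂ) (hreal : ∀ p ∈ T, ∀ v w, (h (e.form p v) (e.form p w)).im = 0)

include hreal in
-- A metric that is real on real vectors has a real Lie derivative along a real field: the
-- derivative of its coefficients is real, and the terms containing `fderiv ℝ X p` are values of the
-- metric on real vectors.
theorem im_lieForm_metric {p : E} (hp : p ∈ T) (X : E → E) (v w : E) :
    (h (lieForm e.form X p v) (e.form p w) + h (e.form p v) (lieForm e.form X p w)).im = 0 := by
  have h1 : ∀ v, HasFDerivAt (fun q => e.form q v) ((fderiv ℝ e.form p).flip v) p := fun v => by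
    have := (e.hasFDerivAt_form hp).clm_apply (hasFDerivAt_const v p)
    simpa using this
  have h2 : HasFDerivAt (fun q => (h (e.form q v) (e.form q w)).im) _ p :=
    imCLM.hasFDerivAt.comp p ((h.hasFDerivAt.comp p (h1 v)).clm_apply (h1 w))
  have h3 : (fun q => (h (e.form q v) (e.form q w)).im) =ᶠ[𝓝 p] fun _ => 0 := by
    filter_upwards [e.isOpen.mem_nhds hp] with q hq using hreal q hq v w
  have h4 := congrArg (fun L => L (X p))
    (h2.unique (h3.hasFDerivAt_iff.2 (hasFDerivAt_const (0 : ℝ) p)))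
  have h5 := hreal p hp (fderiv ℝ X p v) w
  have h6 := hreal p hp v (fderiv ℝ X p w)
  simp [lieForm] at h4 ⊢
  linarith

variable (hI_left : ∀ y z, h (I • y) z = I * h y z) (hI_right : ∀ y z, h y (I • z) = I * h y z)

include hreal hI_left hI_right in
/-- The real part of a complex vector field commuting with the frame is a Killing field. -/
theorem lieForm_metric_eq_zero {p : E} (hp : p ∈ T) {f : E → F} {f' : E →L[ℝ] F}
    (hf : HasFDerivAt f f' p) (hf' : ∀ v, f' v = - e.bracket (e.form p v) (f p)) (v w : E) :
    h (lieForm e.form (fun q => e.re q (f q)) p v) (e.form p w) +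
      h (e.form p v) (lieForm e.form (fun q => e.re q (f q)) p w) = 0 := by
  have hv := e.lieForm_add_I_smul_lieForm hp hf hf' v
  have hw := e.lieForm_add_I_smul_lieForm hp hf hf' w
  have i1 := e.im_lieForm_metric h hreal hp (fun q => e.re q (f q)) v w
  have i2 := e.im_lieForm_metric h hreal hp (fun q => -e.re q (I • f q)) v w
  have h1 := congrArg (fun y => h y (e.form p w)) hv
  have h2 := congrArg (fun y => h (e.form p v) y) hw
  simp only [map_add, add_apply, hI_left, hI_right, map_zero, zero_apply] at h1 h2
  -- With A and B the Lie derivatives of the metric along the real and imaginary parts of the field,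
  -- `h1` and `h2` add up to A + iB = 0. By `i1` and `i2` both A and B are real, whence A = 0.
  have h3 := congrArg Complex.re (congrArg₂ (· + ·) h1 h2)
  apply Complex.ext
  · simp at h3 i2 ⊢
    linarith
  · simpa using i1

end Metric

variable [FiniteDimensional ℝ E]

/-- Locally, there are complex vector fields commuting with the frame having arbitrary values at a
given point. -/
theorem exists_commuting {p₀ : E} (hp₀ : p₀ ∈ T) :
    ∃ (U : Set E) (u : E → F →L[ℝ] F), IsOpen U ∧ U ⊆ T ∧ p₀ ∈ U ∧ ContDiffOn ℝ ∞ u U ∧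
      u p₀ = ContinuousLinearMap.id ℝ F ∧
      ∀ p ∈ U, ∀ v z, fderiv ℝ u p v z = - e.bracket (e.form p v) (u p z) := by
  have : FiniteDimensional ℝ F := FiniteDimensional.complexToReal F
  -- The connection form is minus the adjoint action of `form`, with values in the endomorphism
  -- algebra of `F`; its flatness is Maurer-Cartan combined with Jacobi.
  let c : (E →L[ℝ] F) →L[ℝ] E →L[ℝ] F →L[ℝ] F :=
    - ContinuousLinearMap.compL ℝ E F (F →L[ℝ] F) e.bracket
  have hc : ∀ L v, c L v = - e.bracket (L v) := fun L v => rfl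
  have hA : ContDiffOn ℝ ∞ (fun p => c (e.form p)) T :=
    ContDiff.comp_contDiffOn (g := c)
      (ContinuousLinearMap.contDiff (𝕜 := ℝ) (E := E →L[ℝ] F) (F := E →L[ℝ] F →L[ℝ] F) c)
      e.contDiffOn_form
  have hint : ∀ p ∈ T, ∀ v w, fderiv ℝ (fun p => c (e.form p)) p v w -
      fderiv ℝ (fun p => c (e.form p)) p w v =
      c (e.form p) v * c (e.form p) w - c (e.form p) w * c (e.form p) v := by
    intro p hp v w
    have h1 : fderiv ℝ (fun p => c (e.form p)) p = c ∘L fderiv ℝ e.form p :=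
      (HasFDerivAt.comp (g := c) p (ContinuousLinearMap.hasFDerivAt (𝕜 := ℝ) (E := E →L[ℝ] F)
        (F := E →L[ℝ] F →L[ℝ] F) c) (e.hasFDerivAt_form hp)).fderiv
    rw [h1]
    ext z
    have h2 := congrArg (fun y => e.bracket y z) (e.maurerCartan hp v w)
    have h3 := e.jacobi hp (e.form p v) (e.form p w) z
    simp only [map_sub, map_neg, sub_apply, neg_apply] at h2
    simp only [ContinuousLinearMap.comp_apply, hc, sub_apply, neg_apply,
      mul_apply_eq_comp, map_neg, neg_neg]
    linear_combination (norm := module) -h2 + h3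
  obtain ⟨U, u, hU, hUT, hpU, hu, hu0, hDu⟩ := exists_parallel_section e.isOpen hA hint hp₀
  refine ⟨U, u, hU, hUT, hpU, hu, hu0, fun p hp v z => ?_⟩
  rw [hDu p hp v, hc]
  rfl

/-- Locally, there are Killing fields having arbitrary values at a given point. -/
theorem exists_killing (h : F →L[ℝ] F →L[ℝ] ℂ)
    (hreal : ∀ p ∈ T, ∀ v w, (h (e.form p v) (e.form p w)).im = 0)
    (hI_left : ∀ y z, h (I • y) z = I * h y z) (hI_right : ∀ y z, h y (I • z) = I * h y z)
    {p₀ : E} (hp₀ : p₀ ∈ T) :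
    ∃ (U : Set E) (X : E → F →L[ℝ] E), IsOpen U ∧ U ⊆ T ∧ p₀ ∈ U ∧ ContDiffOn ℝ ∞ X U ∧
      X p₀ = e.re p₀ ∧ ∀ p ∈ U, ∀ z v w,
        h (lieForm e.form (fun q => X q z) p v) (e.form p w) +
          h (e.form p v) (lieForm e.form (fun q => X q z) p w) = 0 := by
  obtain ⟨U, u, hU, hUT, hpU, hu, hu0, hDu⟩ := e.exists_commuting hp₀
  -- Real parts of the commuting fields. As `u p₀` is the identity, their values at `p₀` are those
  -- of the frame and fill the tangent space.
  refine ⟨U, fun p => e.re p ∘L u p, hU, hUT, hpU, (e.contDiffOn.mono hUT).clm_comp hu, ?_,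
    fun p hp z v w => ?_⟩
  · simp only [hu0]
    rfl
  · have h1 := ((hu.contDiffAt (hU.mem_nhds hp)).differentiableAt (by simp)).hasFDerivAt.clm_apply
      (hasFDerivAt_const z p)
    exact e.lieForm_metric_eq_zero h hreal hI_left hI_right (hUT hp) h1
      (fun v => by simpa using hDu p hp v z) v w

omit [FiniteDimensional ℝ E] in
theorem range_re {p : E} (hp : p ∈ T) : (e.re p).range = ⊤ :=
  LinearMap.range_eq_top.2 fun v => ⟨e.form p v, e.re_form hp v⟩

omit [FiniteDimensional ℝ E] in
/-- A real vector field commuting with the frame preserves the form of the frame. -/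
theorem lieForm_eq_zero {p : E} (hp : p ∈ T) {X : E → E}
    (hX : ∀ z, fderiv ℝ X p (e.re p z) = fderiv ℝ e.re p (X p) z) (v : E) :
    lieForm e.form X p v = 0 := by
  have h := e.fderiv_form_re hp (X p) (e.form p v)
  simpa [lieForm, ← hX, hp] using h

omit [FiniteDimensional ℝ E] in
-- For a field Y, the derivative of θ(Y) along X is (L_X θ)(Y) + θ([X, Y]). With Y the real part of
-- a frame field, both terms vanish when X commutes with all such real parts.
theorem fderiv_form_re_eq_zero {p : E} (hp : p ∈ T) {X : E → E}
    (hX : ∀ z, fderiv ℝ X p (e.re p z) = fderiv ℝ e.re p (X p) z) (z : F) :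
    fderiv ℝ (fun q => e.form q (e.re q z)) p (X p) = 0 := by
  have h1 := (e.hasFDerivAt_form hp).clm_apply
    ((e.hasFDerivAt_re hp).clm_apply (hasFDerivAt_const z p))
  rw [HasFDerivAt.fderiv h1, ← e.lieForm_eq_zero hp hX (e.re p z), lieForm, hX]
  simp [add_comm]

end ComplexFrame

end

/-! ### Vector fields on the manifold and their chart expressions -/

noncomputable section

open scoped Topology
open Set Filter VectorField

section Chart

variable {E : Type*} [NormedAddCommGroup E] [NormedSpace ℝ E]
  {M : Type*} [TopologicalSpace M] [ChartedSpace E M] [IsManifold 𝓘(ℝ, E) ∞ M]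

/-- The derivative of the inverse of the preferred chart at `c`. -/
def chartDeriv (c : M) (p : E) :
    E →L[ℝ] TangentSpace 𝓘(ℝ, E) ((extChartAt 𝓘(ℝ, E) c).symm p) :=
  mfderiv 𝓘(ℝ, E) 𝓘(ℝ, E) (extChartAt 𝓘(ℝ, E) c).symm p

/-- The expression of a vector field in the preferred chart at `c`. -/
def chartRep (c : M) (V : RealVF E M) (p : E) : E :=
  (chartDeriv c p).inverse (V ((extChartAt 𝓘(ℝ, E) c).symm p))

/-- A map from `E` to itself, as a vector field on the manifold `E`. -/
def toVectorField (X : E → E) (p : E) : TangentSpace 𝓘(ℝ, E) p := X p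

/-- The vector field on `M` having a given expression in the preferred chart at `c`. -/
def ofChart (c : M) (X : E → E) : RealVF E M := fun x =>
  mpullback 𝓘(ℝ, E) 𝓘(ℝ, E) (extChartAt 𝓘(ℝ, E) c) (toVectorField X) x

variable {c : M} {p : E}

theorem one_le_infty : (1 : WithTop ℕ∞) ≤ ∞ := one_le_two.trans two_le_infty

instance isManifold_one : IsManifold 𝓘(ℝ, E) 1 M := IsManifold.of_le (n := ∞) one_le_infty

instance isManifold_minSmoothness_two : IsManifold 𝓘(ℝ, E) (minSmoothness ℝ 2) M :=
  IsManifold.of_le (n := ∞) (by simpa using two_le_infty)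

theorem contMDiffAt_chart_symm (hp : p ∈ (extChartAt 𝓘(ℝ, E) c).target) :
    ContMDiffAt 𝓘(ℝ, E) 𝓘(ℝ, E) ∞ (extChartAt 𝓘(ℝ, E) c).symm p :=
  (contMDiffOn_extChartAt_symm c).contMDiffAt ((isOpen_extChartAt_target c).mem_nhds hp)

theorem contMDiffAt_chart {x : M} (hx : x ∈ (extChartAt 𝓘(ℝ, E) c).source) :
    ContMDiffAt 𝓘(ℝ, E) 𝓘(ℝ, E) ∞ (extChartAt 𝓘(ℝ, E) c) x :=
  (contMDiffOn_extChartAt (x := c)).contMDiffAt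
    ((chartAt E c).open_source.mem_nhds (by simpa using hx))

theorem mfderiv_chart_chartDeriv (hp : p ∈ (extChartAt 𝓘(ℝ, E) c).target) (v : E) :
    mfderiv 𝓘(ℝ, E) 𝓘(ℝ, E) (extChartAt 𝓘(ℝ, E) c) ((extChartAt 𝓘(ℝ, E) c).symm p)
      (chartDeriv c p v) = v := by
  have h := mfderiv_extChartAt_comp_mfderivWithin_extChartAt_symm (I := 𝓘(ℝ, E)) hp
  rw [ModelWithCorners.range_eq_univ, mfderivWithin_univ] at h
  exact congrArg (fun L => L v) h

theorem isInvertible_mfderiv_chart_symm (hp : p ∈ (extChartAt 𝓘(ℝ, E) c).target) :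
    (mfderiv 𝓘(ℝ, E) 𝓘(ℝ, E) (extChartAt 𝓘(ℝ, E) c).symm p).IsInvertible := by
  have h := isInvertible_mfderivWithin_extChartAt_symm (I := 𝓘(ℝ, E)) hp
  rwa [ModelWithCorners.range_eq_univ, mfderivWithin_univ] at h

theorem isInvertible_chartDeriv (hp : p ∈ (extChartAt 𝓘(ℝ, E) c).target) :
    (chartDeriv c p).IsInvertible :=
  isInvertible_mfderiv_chart_symm hp

theorem chartDeriv_inverse (hp : p ∈ (extChartAt 𝓘(ℝ, E) c).target)
    (v : TangentSpace 𝓘(ℝ, E) ((extChartAt 𝓘(ℝ, E) c).symm p)) :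
    chartDeriv c p ((chartDeriv c p).inverse v) = v := by
  obtain ⟨L, hL⟩ := isInvertible_chartDeriv hp
  rw [← hL, ContinuousLinearMap.inverse_equiv]
  exact L.apply_symm_apply v

theorem inverse_chartDeriv (hp : p ∈ (extChartAt 𝓘(ℝ, E) c).target) (v : E) :
    (chartDeriv c p).inverse (chartDeriv c p v) = v := by
  obtain ⟨L, hL⟩ := isInvertible_chartDeriv hp
  rw [← hL, ContinuousLinearMap.inverse_equiv]
  exact L.symm_apply_apply v

theorem chartDeriv_chartRep (hp : p ∈ (extChartAt 𝓘(ℝ, E) c).target) (V : RealVF E M) :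
    chartDeriv c p (chartRep c V p) = V ((extChartAt 𝓘(ℝ, E) c).symm p) :=
  chartDeriv_inverse hp _

theorem chartDeriv_of_ofChart (hp : p ∈ (extChartAt 𝓘(ℝ, E) c).target) (X : E → E) :
    ofChart c X ((extChartAt 𝓘(ℝ, E) c).symm p) = chartDeriv c p (X p) := by
  have hinv : (mfderiv 𝓘(ℝ, E) 𝓘(ℝ, E) (extChartAt 𝓘(ℝ, E) c)
    ((extChartAt 𝓘(ℝ, E) c).symm p)).IsInvertible :=
    isInvertible_mfderiv_extChartAt ((extChartAt 𝓘(ℝ, E) c).map_target hp)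
  have h1 := mfderiv_chart_chartDeriv hp (X p)
  rw [ofChart, mpullback_apply]
  have h2 : toVectorField X ((extChartAt 𝓘(ℝ, E) c) ((extChartAt 𝓘(ℝ, E) c).symm p)) = X p := by
    rw [toVectorField, (extChartAt 𝓘(ℝ, E) c).right_inv hp]
  obtain ⟨L, hL⟩ := hinv
  rw [← hL] at h1 ⊢
  rw [ContinuousLinearMap.inverse_equiv]
  refine L.injective ?_
  exact (L.apply_symm_apply _).trans (h2.trans h1.symm)

theorem chartRep_ofChart (hp : p ∈ (extChartAt 𝓘(ℝ, E) c).target) (X : E → E) :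
    chartRep c (ofChart c X) p = X p := by
  rw [chartRep, chartDeriv_of_ofChart hp, inverse_chartDeriv hp]

variable [CompleteSpace E]

theorem contDiffAt_chartRep (hp : p ∈ (extChartAt 𝓘(ℝ, E) c).target) {V : RealVF E M}
    (hV : ContMDiffAt 𝓘(ℝ, E) 𝓘(ℝ, E).tangent ∞
      (fun x => (⟨x, V x⟩ : TangentBundle 𝓘(ℝ, E) M)) ((extChartAt 𝓘(ℝ, E) c).symm p)) :
    ContDiffAt ℝ ∞ (chartRep c V) p :=
  (contMDiffAt_vectorSpace_iff_contDiffAt (V := toVectorField (chartRep c V))).1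
    (ContMDiffAt.mpullback_vectorField_preimage hV (contMDiffAt_chart_symm hp)
      (isInvertible_mfderiv_chart_symm hp) le_rfl)

/-- Pullback by the inverse chart respects brackets, and on `E` the manifold bracket is the ordinary
one. -/
theorem chartRep_mlieBracket (hp : p ∈ (extChartAt 𝓘(ℝ, E) c).target) {V W : RealVF E M}
    (hV : MDifferentiableAt 𝓘(ℝ, E) 𝓘(ℝ, E).tangent
      (fun x => (⟨x, V x⟩ : TangentBundle 𝓘(ℝ, E) M)) ((extChartAt 𝓘(ℝ, E) c).symm p))
    (hW : MDifferentiableAt 𝓘(ℝ, E) 𝓘(ℝ, E).tangent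
      (fun x => (⟨x, W x⟩ : TangentBundle 𝓘(ℝ, E) M)) ((extChartAt 𝓘(ℝ, E) c).symm p)) :
    chartRep c (mlieBracket 𝓘(ℝ, E) V W) p = lieBracket ℝ (chartRep c V) (chartRep c W) p := by
  have h := mpullback_mlieBracket (n := ∞) hV hW (contMDiffAt_chart_symm hp)
    (by simpa using two_le_infty)
  have h2 := congrFun (mlieBracketWithin_eq_lieBracketWithin
    (V := toVectorField (chartRep c V)) (W := toVectorField (chartRep c W)) (s := univ)) p
  have h3 : lieBracketWithin ℝ (chartRep c V) (chartRep c W) univ p =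
      lieBracket ℝ (chartRep c V) (chartRep c W) p := by rw [lieBracketWithin_univ]
  rw [mlieBracketWithin_univ] at h2
  exact h.trans (h2.trans h3)

theorem contMDiffAt_ofChart {x : M} (hx : x ∈ (extChartAt 𝓘(ℝ, E) c).source) {X : E → E}
    (hX : ContDiffAt ℝ ∞ X (extChartAt 𝓘(ℝ, E) c x)) :
    ContMDiffAt 𝓘(ℝ, E) 𝓘(ℝ, E).tangent ∞
      (fun x => (⟨x, ofChart c X x⟩ : TangentBundle 𝓘(ℝ, E) M)) x :=
  ContMDiffAt.mpullback_vectorField_preimage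
    ((contMDiffAt_vectorSpace_iff_contDiffAt (V := toVectorField X)).2 hX)
    (contMDiffAt_chart hx) (isInvertible_mfderiv_extChartAt hx) le_rfl

omit [CompleteSpace E] in
theorem mvfderiv_chartDeriv (hp : p ∈ (extChartAt 𝓘(ℝ, E) c).target) {f : M → ℝ} {f' : E →L[ℝ] ℝ}
    (hf : HasFDerivAt (fun q => f ((extChartAt 𝓘(ℝ, E) c).symm q)) f' p) (v : E) :
    mvfderiv 𝓘(ℝ, E) f ((extChartAt 𝓘(ℝ, E) c).symm p) (chartDeriv c p v) = f' v := by
  set x := (extChartAt 𝓘(ℝ, E) c).symm p with hx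
  have hxs : x ∈ (extChartAt 𝓘(ℝ, E) c).source := (extChartAt 𝓘(ℝ, E) c).map_target hp
  have hψ := ((contMDiffAt_chart hxs).mdifferentiableAt (by simp)).hasMFDerivAt
  have hψx : extChartAt 𝓘(ℝ, E) c x = p := (extChartAt 𝓘(ℝ, E) c).right_inv hp
  rw [← hψx] at hf
  have h1 := hf.hasMFDerivAt.comp x hψ
  have h2 : ((fun q => f ((extChartAt 𝓘(ℝ, E) c).symm q)) ∘ extChartAt 𝓘(ℝ, E) c) =ᶠ[𝓝 x] f := by
    filter_upwards [(isOpen_extChartAt_source (I := 𝓘(ℝ, E)) c).mem_nhds hxs] with y hy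
    simp only [Function.comp_apply, (extChartAt 𝓘(ℝ, E) c).left_inv hy]
  have h3 := h1.congr_of_eventuallyEq h2.symm
  rw [mvfderiv, h3.mfderiv]
  exact congrArg f' (mfderiv_chart_chartDeriv hp v)

end Chart

end

/-! ### The frame defined by the Lie algebra in a chart -/

noncomputable section

open scoped Topology
open Set Filter VectorField

section Frame

variable {E : Type*} [NormedAddCommGroup E] [NormedSpace ℝ E]
  {M : Type*} [TopologicalSpace M] [ChartedSpace E M]
  {Z : Submodule ℂ (ComplexVF E M)} {F : Type*} [NormedAddCommGroup F] [NormedSpace ℂ F]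
  (ι : F ≃ₗ[ℂ] Z)

/-- The real part of the field with parameter `z`. -/
def reField (z : F) : RealVF E M := ComplexVF.re (ι z : ComplexVF E M)

theorem reField_add (y z : F) : reField ι (y + z) = reField ι y + reField ι z := by
  ext x
  simp [reField, ComplexVF.re]

theorem reField_smul (r : ℝ) (z : F) : reField ι (r • z) = r • reField ι z := by
  ext x
  have h : (r • z : F) = (r : ℂ) • z := (Complex.coe_smul r z).symm
  have h' := Complexification.smul_re (r : ℂ) ((ι z : ComplexVF E M) x)
  rw [Complex.ofReal_re, Complex.ofReal_im, zero_smul, sub_zero] at h'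
  rw [reField, h, map_smul]
  exact h'

/-- Because of this relation, real parts alone determine the frame. -/
theorem reField_I (z : F) : reField ι (Complex.I • z) = - ComplexVF.im (ι z : ComplexVF E M) := by
  ext x
  simp [reField, ComplexVF.re, ComplexVF.im]

theorem im_eq_neg_reField (z : F) :
    ComplexVF.im (ι z : ComplexVF E M) = - reField ι (Complex.I • z) := by
  rw [reField_I, neg_neg]

variable [IsManifold 𝓘(ℝ, E) ∞ M]

section ChartRep

variable (c : M) (p : E)

omit [IsManifold 𝓘(ℝ, E) ∞ M] in
theorem chartRep_add (V W : RealVF E M) :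
    chartRep c (V + W) p = chartRep c V p + chartRep c W p :=
  map_add _ _ _

omit [IsManifold 𝓘(ℝ, E) ∞ M] in
theorem chartRep_smul (r : ℝ) (V : RealVF E M) : chartRep c (r • V) p = r • chartRep c V p :=
  map_smul _ _ _

omit [IsManifold 𝓘(ℝ, E) ∞ M] in
theorem chartRep_neg (V : RealVF E M) : chartRep c (-V) p = - chartRep c V p :=
  map_neg _ _

omit [IsManifold 𝓘(ℝ, E) ∞ M] in
theorem chartRep_sub (V W : RealVF E M) :
    chartRep c (V - W) p = chartRep c V p - chartRep c W p :=
  map_sub _ _ _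

end ChartRep

variable [FiniteDimensional ℂ F]

instance finiteDimensional_real : FiniteDimensional ℝ F := FiniteDimensional.complexToReal F

/-- The real parts of the fields in `Z`, expressed in the preferred chart at `c`. -/
def frameRe (c : M) (p : E) : F →L[ℝ] E :=
  LinearMap.toContinuousLinearMap
    { toFun := fun z => chartRep c (reField ι z) p
      map_add' := fun y z => by rw [reField_add, chartRep_add]
      map_smul' := fun r z => by rw [reField_smul, chartRep_smul]; rfl }

omit [IsManifold 𝓘(ℝ, E) ∞ M] in
theorem frameRe_apply (c : M) (p : E) (z : F) : frameRe ι c p z = chartRep c (reField ι z) p := rfl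

omit [IsManifold 𝓘(ℝ, E) ∞ M] in
theorem chartRep_im (c : M) (p : E) (z : F) :
    chartRep c (ComplexVF.im (ι z : ComplexVF E M)) p = - frameRe ι c p (Complex.I • z) := by
  rw [im_eq_neg_reField, chartRep_neg]
  rfl

variable (hZ : IsComplexLieAlgebra Z) (htriv : TrivializesComplex Z)

include hZ

omit [FiniteDimensional ℂ F] in
theorem smooth_reField (z : F) : RealVF.Smooth (reField ι z) :=
  (hZ.smooth _ (ι z).2).1

omit [FiniteDimensional ℂ F] in
theorem smooth_im (z : F) : RealVF.Smooth (ComplexVF.im (ι z : ComplexVF E M)) :=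
  (hZ.smooth _ (ι z).2).2

variable [FiniteDimensional ℝ E]

theorem contDiffOn_frameRe (c : M) :
    ContDiffOn ℝ ∞ (frameRe ι c) (extChartAt 𝓘(ℝ, E) c).target := by
  have : CompleteSpace E := FiniteDimensional.complete ℝ E
  exact contDiffOn_clm_apply.2 fun z p hp =>
    (contDiffAt_chartRep hp (smooth_reField ι hZ z).contMDiffAt).contDiffWithinAt

/-- The parameter of the bracket of two fields. -/
def rawBracket (y z : F) : F :=
  ι.symm ⟨ComplexVF.bracket (ι y : ComplexVF E M) (ι z), hZ.bracket_mem _ (ι y).2 _ (ι z).2⟩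

omit [FiniteDimensional ℂ F] [FiniteDimensional ℝ E] in
theorem coe_rawBracket (y z : F) :
    (ι (rawBracket ι hZ y z) : ComplexVF E M) = ComplexVF.bracket (ι y : ComplexVF E M) (ι z) := by
  simp [rawBracket]

variable {c : M} {p : E}

theorem frameRe_rawBracket (hp : p ∈ (extChartAt 𝓘(ℝ, E) c).target) (y z : F) :
    frameRe ι c p (rawBracket ι hZ y z) =
      lieBracket ℝ (fun q => frameRe ι c q y) (fun q => frameRe ι c q z) p -
      lieBracket ℝ (fun q => frameRe ι c q (Complex.I • y))
        (fun q => frameRe ι c q (Complex.I • z)) p := by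
  have : CompleteSpace E := FiniteDimensional.complete ℝ E
  have hd : ∀ {V : RealVF E M}, RealVF.Smooth V → MDifferentiableAt 𝓘(ℝ, E) 𝓘(ℝ, E).tangent
      (fun x => (⟨x, V x⟩ : TangentBundle 𝓘(ℝ, E) M)) ((extChartAt 𝓘(ℝ, E) c).symm p) :=
    fun hV => hV.contMDiffAt.mdifferentiableAt (by simp)
  have h1 : reField ι (rawBracket ι hZ y z) =
      mlieBracket 𝓘(ℝ, E) (reField ι y) (reField ι z) -
      mlieBracket 𝓘(ℝ, E) (ComplexVF.im (ι y : ComplexVF E M)) (ComplexVF.im (ι z)) := by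
    rw [reField, coe_rawBracket]
    rfl
  have hi : ∀ z, chartRep c (ComplexVF.im (ι z : ComplexVF E M)) =
      fun p => - frameRe ι c p (Complex.I • z) := fun z => funext fun p => chartRep_im ι c p z
  rw [frameRe_apply, h1, chartRep_sub, chartRep_mlieBracket hp (hd (smooth_reField ι hZ y))
    (hd (smooth_reField ι hZ z)), chartRep_mlieBracket hp (hd (smooth_im ι hZ y))
    (hd (smooth_im ι hZ z)), hi, hi]
  simp only [lieBracket_eq, fderiv_fun_neg, neg_apply, map_neg, neg_neg]
  rfl

theorem frameRe_I_rawBracket (hp : p ∈ (extChartAt 𝓘(ℝ, E) c).target) (y z : F) :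
    frameRe ι c p (Complex.I • rawBracket ι hZ y z) =
      lieBracket ℝ (fun q => frameRe ι c q y) (fun q => frameRe ι c q (Complex.I • z)) p +
      lieBracket ℝ (fun q => frameRe ι c q (Complex.I • y)) (fun q => frameRe ι c q z) p := by
  have : CompleteSpace E := FiniteDimensional.complete ℝ E
  have hd : ∀ {V : RealVF E M}, RealVF.Smooth V → MDifferentiableAt 𝓘(ℝ, E) 𝓘(ℝ, E).tangent
      (fun x => (⟨x, V x⟩ : TangentBundle 𝓘(ℝ, E) M)) ((extChartAt 𝓘(ℝ, E) c).symm p) :=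
    fun hV => hV.contMDiffAt.mdifferentiableAt (by simp)
  have h1 : reField ι (Complex.I • rawBracket ι hZ y z) =
      -(mlieBracket 𝓘(ℝ, E) (reField ι y) (ComplexVF.im (ι z : ComplexVF E M)) +
      mlieBracket 𝓘(ℝ, E) (ComplexVF.im (ι y : ComplexVF E M)) (reField ι z)) := by
    rw [reField_I, coe_rawBracket]
    rfl
  have hi : ∀ z, chartRep c (ComplexVF.im (ι z : ComplexVF E M)) =
      fun p => - frameRe ι c p (Complex.I • z) := fun z => funext fun p => chartRep_im ι c p z
  rw [frameRe_apply, h1, chartRep_neg, chartRep_add,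
    chartRep_mlieBracket hp (hd (smooth_reField ι hZ y)) (hd (smooth_im ι hZ z)),
    chartRep_mlieBracket hp (hd (smooth_im ι hZ y)) (hd (smooth_reField ι hZ z)), hi, hi]
  simp only [lieBracket_eq, fderiv_fun_neg, neg_apply, map_neg]
  simp only [frameRe_apply]
  abel

omit hZ [FiniteDimensional ℝ E] in
include htriv in
theorem bijective_frameRe (hp : p ∈ (extChartAt 𝓘(ℝ, E) c).target) :
    Function.Bijective fun z => (frameRe ι c p z, frameRe ι c p (Complex.I • z)) := by
  set x := (extChartAt 𝓘(ℝ, E) c).symm p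
  have hinv : ∀ v w, (chartDeriv c p).inverse v = (chartDeriv c p).inverse w → v = w := by
    intro v w h
    rw [← chartDeriv_inverse hp v, h, chartDeriv_inverse hp w]
  constructor
  · intro y z h
    have h1 := hinv _ _ (Prod.ext_iff.1 h).1
    have h2 := Prod.ext_iff.1 h |>.2
    simp only [frameRe_apply, reField_I, chartRep_neg, neg_inj] at h2
    have h3 := hinv _ _ h2
    exact ι.injective ((htriv.2 x).1 (Complexification.ext h1 h3))
  · rintro ⟨a, b⟩
    obtain ⟨u, hu⟩ := (htriv.2 x).2 ⟨chartDeriv c p a, chartDeriv c p (-b)⟩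
    refine ⟨ι.symm u, Prod.ext ?_ ?_⟩
    · show chartRep c (reField ι (ι.symm u)) p = a
      rw [chartRep, reField, ι.apply_symm_apply]
      show (chartDeriv c p).inverse ((u : ComplexVF E M) x).re = a
      have hu' : (u : ComplexVF E M) x = ⟨chartDeriv c p a, chartDeriv c p (-b)⟩ := hu
      rw [hu', inverse_chartDeriv hp]
    · show chartRep c (reField ι (Complex.I • ι.symm u)) p = b
      rw [reField_I, chartRep_neg, chartRep, ι.apply_symm_apply]
      show -(chartDeriv c p).inverse ((u : ComplexVF E M) x).im = b
      have hu' : (u : ComplexVF E M) x = ⟨chartDeriv c p a, chartDeriv c p (-b)⟩ := hu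
      rw [hu', inverse_chartDeriv hp, neg_neg]

include htriv in
-- Bilinearity can be tested at one point, where evaluation is injective and both parts of the
-- bracket are bilinear expressions in the frame and its first derivative.
theorem exists_bracket [Nonempty M] : ∃ B : F →L[ℝ] F →L[ℝ] F,
    (∀ y z, B y z = rawBracket ι hZ y z) ∧ (∀ y z, B (Complex.I • y) z = Complex.I • B y z) ∧
      ∀ y z, B y (Complex.I • z) = Complex.I • B y z := by
  obtain ⟨c⟩ := ‹Nonempty M›
  set p := extChartAt 𝓘(ℝ, E) c c
  have hp : p ∈ (extChartAt 𝓘(ℝ, E) c).target := mem_extChartAt_target c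
  have hinj : ∀ y z, frameRe ι c p y = frameRe ι c p z →
      frameRe ι c p (Complex.I • y) = frameRe ι c p (Complex.I • z) → y = z :=
    fun y z h1 h2 => (bijective_frameRe ι htriv hp).1 (Prod.ext h1 h2)
  have hD := (((contDiffOn_frameRe ι hZ c).contDiffAt
    ((isOpen_extChartAt_target c).mem_nhds hp)).differentiableAt (by simp)).hasFDerivAt
  have hDz : ∀ v z, fderiv ℝ (fun q => frameRe ι c q z) p v =
      fderiv ℝ (frameRe ι c) p v z := fun v z => by
    have h := hD.clm_apply (hasFDerivAt_const z p)
    simpa using congrArg (fun L => L v) h.fderiv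
  have hR := frameRe_rawBracket ι hZ hp
  have hS := frameRe_I_rawBracket ι hZ hp
  have hII : ∀ z : F, Complex.I • Complex.I • z = -z := fun z => by
    rw [smul_smul, Complex.I_mul_I, neg_one_smul]
  have hIr : ∀ (r : ℝ) (z : F), Complex.I • r • z = r • Complex.I • z := fun r z =>
    smul_comm _ _ _
  simp only [lieBracket_eq, hDz] at hR hS
  refine ⟨LinearMap.toContinuousBilinearMap (LinearMap.mk₂ ℝ (rawBracket ι hZ) (fun x y z => ?_)
    (fun r y z => ?_) (fun x y z => ?_) (fun r y z => ?_)), fun y z => rfl, fun y z => ?_,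
    fun y z => ?_⟩
  · apply hinj <;> simp only [smul_add, map_add, add_apply, hR, hS] <;> abel
  · apply hinj <;> simp only [hIr, map_smul, smul_apply, hR, hS] <;> module
  · apply hinj <;> simp only [smul_add, map_add, add_apply, hR, hS] <;> abel
  · apply hinj <;> simp only [hIr, map_smul, smul_apply, hR, hS] <;> module
  · show rawBracket ι hZ (Complex.I • y) z = Complex.I • rawBracket ι hZ y z
    apply hinj <;> simp only [hII, map_neg, neg_apply, hR, hS] <;> abel
  · show rawBracket ι hZ y (Complex.I • z) = Complex.I • rawBracket ι hZ y z
    apply hinj <;> simp only [hII, map_neg, neg_apply, hR, hS] <;> abel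

/-- The frame of complex vector fields obtained by expressing a trivializing Lie algebra of complex
vector fields in the preferred chart at `c`. -/
def chartFrame (c : M) : ComplexFrame (extChartAt 𝓘(ℝ, E) c).target F :=
  haveI : Nonempty M := ⟨c⟩
  { re := frameRe ι c
    bracket := (exists_bracket ι hZ htriv).choose
    isOpen := isOpen_extChartAt_target c
    contDiffOn := contDiffOn_frameRe ι hZ c
    bijective := fun _ hp => bijective_frameRe ι htriv hp
    bracket_I_left := (exists_bracket ι hZ htriv).choose_spec.2.1
    bracket_I_right := (exists_bracket ι hZ htriv).choose_spec.2.2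
    re_bracket := fun p hp y z => by
      rw [(exists_bracket ι hZ htriv).choose_spec.1, frameRe_rawBracket ι hZ hp] }

end Frame

end

/-! ### The metric in terms of the frame, and local homogeneity -/

noncomputable section

open scoped Topology
open Set Filter VectorField

section Metric

variable {E : Type*} [NormedAddCommGroup E] [NormedSpace ℝ E]
  {M : Type*} [TopologicalSpace M] [ChartedSpace E M] [IsManifold 𝓘(ℝ, E) ∞ M]

namespace PseudoRiemannianMetric

variable (g : PseudoRiemannianMetric E M)

theorem complexVal_add_left (x : M) (u v w : Complexification (TangentSpace 𝓘(ℝ, E) x)) :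
    g.complexVal x (u + v) w = g.complexVal x u w + g.complexVal x v w := by
  apply Complex.ext <;> simp [complexVal] <;> ring

theorem complexVal_add_right (x : M) (u v w : Complexification (TangentSpace 𝓘(ℝ, E) x)) :
    g.complexVal x u (v + w) = g.complexVal x u v + g.complexVal x u w := by
  apply Complex.ext <;> simp [complexVal] <;> ring

theorem complexVal_smul_left (x : M) (a : ℂ) (v w : Complexification (TangentSpace 𝓘(ℝ, E) x)) :
    g.complexVal x (a • v) w = a * g.complexVal x v w := by
  apply Complex.ext <;> simp [complexVal] <;> ring

theorem complexVal_smul_right (x : M) (a : ℂ) (v w : Complexification (TangentSpace 𝓘(ℝ, E) x)) :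
    g.complexVal x v (a • w) = a * g.complexVal x v w := by
  apply Complex.ext <;> simp [complexVal] <;> ring

/-- The points `x` and `y` correspond under an isometry between open sets. -/
def LocallyIsometricAt (x y : M) : Prop :=
  ∃ φ : OpenPartialHomeomorph M M, x ∈ φ.source ∧ φ x = y ∧
    ContMDiffOn 𝓘(ℝ, E) 𝓘(ℝ, E) ∞ φ φ.source ∧
    ContMDiffOn 𝓘(ℝ, E) 𝓘(ℝ, E) ∞ φ.symm φ.target ∧
    ∀ p ∈ φ.source, ∀ u v : TangentSpace 𝓘(ℝ, E) p,
      g.val (φ p) (mfderiv 𝓘(ℝ, E) 𝓘(ℝ, E) φ p u) (mfderiv 𝓘(ℝ, E) 𝓘(ℝ, E) φ p v) = g.val p u v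

variable {g}

/-- All tangent spaces are definitionally `E`, so forms at equal points can be compared without
transporting vectors. -/
theorem val_congr {x y : M} (h : x = y) (u v : E) :
    (g.val x : E →L[ℝ] E →L[ℝ] ℝ) u v = (g.val y : E →L[ℝ] E →L[ℝ] ℝ) u v := by
  subst h
  rfl

theorem LocallyIsometricAt.symm {x y : M} (h : g.LocallyIsometricAt x y) :
    g.LocallyIsometricAt y x := by
  obtain ⟨φ, hx, rfl, h1, h2, h3⟩ := h
  refine ⟨φ.symm, φ.map_source hx, φ.left_inv hx, h2, by simpa using h1, fun p hp u v => ?_⟩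
  have hp' : p ∈ φ.target := hp
  have hq := φ.map_target hp'
  have hφ := ((h1.contMDiffAt (φ.open_source.mem_nhds hq)).mdifferentiableAt (by simp)).hasMFDerivAt
  have hφs := ((h2.contMDiffAt (φ.open_target.mem_nhds hp')).mdifferentiableAt
    (by simp)).hasMFDerivAt
  have hid : φ ∘ φ.symm =ᶠ[𝓝 p] id := by
    filter_upwards [φ.open_target.mem_nhds hp'] with q hq using φ.right_inv hq
  have h4 := ((hφ.comp p hφs).congr_of_eventuallyEq hid.symm).mfderiv
  rw [mfderiv_id] at h4
  have h5 : ∀ w : E, mfderiv 𝓘(ℝ, E) 𝓘(ℝ, E) φ (φ.symm p)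
      (mfderiv 𝓘(ℝ, E) 𝓘(ℝ, E) φ.symm p w) = w := fun w =>
    (congrArg (fun L : E →L[ℝ] E => L w) h4).symm
  rw [← h3 _ hq]
  refine (val_congr (φ.right_inv hp') _ _).trans ?_
  erw [h5 u, h5 v]

theorem LocallyIsometricAt.trans {x y z : M} (h : g.LocallyIsometricAt x y)
    (h' : g.LocallyIsometricAt y z) : g.LocallyIsometricAt x z := by
  obtain ⟨φ, hx, rfl, h1, h2, h3⟩ := h
  obtain ⟨χ, hy, rfl, k1, k2, k3⟩ := h'
  refine ⟨φ.trans χ, ?_, rfl, ?_, ?_, fun p hp u v => ?_⟩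
  · rw [OpenPartialHomeomorph.trans_source]
    exact ⟨hx, hy⟩
  · rw [OpenPartialHomeomorph.trans_source]
    exact k1.comp (h1.mono inter_subset_left) inter_subset_right
  · rw [OpenPartialHomeomorph.trans_target]
    exact h2.comp (k2.mono inter_subset_left) inter_subset_right
  · rw [OpenPartialHomeomorph.trans_source] at hp
    have hφ := ((h1.contMDiffAt (φ.open_source.mem_nhds hp.1)).mdifferentiableAt
      (by simp)).hasMFDerivAt
    have hχ := ((k1.contMDiffAt (χ.open_source.mem_nhds hp.2)).mdifferentiableAt
      (by simp)).hasMFDerivAt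
    have h4 := (hχ.comp p hφ).mfderiv
    rw [← h3 p hp.1, ← k3 _ hp.2]
    erw [h4]
    rfl

/-- On a connected manifold, it is enough to relate each point to the nearby ones. -/
theorem locallyHomogeneous_of_eventually [ConnectedSpace M]
    (h : ∀ x : M, ∀ᶠ y in 𝓝 x, g.LocallyIsometricAt x y) : g.LocallyHomogeneous := fun x y =>
  haveI : Std.Symm g.LocallyIsometricAt := ⟨fun _ _ => .symm⟩
  PreconnectedSpace.induction₂ g.LocallyIsometricAt h ⟨fun _ _ _ => .trans⟩ x y

end PseudoRiemannianMetric

end Metric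

section Chart

variable {E : Type*} [NormedAddCommGroup E] [NormedSpace ℝ E]
  {M : Type*} [TopologicalSpace M] [ChartedSpace E M] [IsManifold 𝓘(ℝ, E) ∞ M]

theorem contMDiffOn_conj_chart (c : M) {f : E → E} {s : Set E} (hf : ContDiffOn ℝ ∞ f s) :
    ContMDiffOn 𝓘(ℝ, E) 𝓘(ℝ, E) ∞
      (fun x => (extChartAt 𝓘(ℝ, E) c).symm (f (extChartAt 𝓘(ℝ, E) c x)))
      {x | x ∈ (extChartAt 𝓘(ℝ, E) c).source ∧ extChartAt 𝓘(ℝ, E) c x ∈ s ∧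
        f (extChartAt 𝓘(ℝ, E) c x) ∈ (extChartAt 𝓘(ℝ, E) c).target} := by
  have h1 : ContMDiffOn 𝓘(ℝ, E) 𝓘(ℝ, E) ∞ (extChartAt 𝓘(ℝ, E) c)
      {x | x ∈ (extChartAt 𝓘(ℝ, E) c).source ∧ extChartAt 𝓘(ℝ, E) c x ∈ s ∧
        f (extChartAt 𝓘(ℝ, E) c x) ∈ (extChartAt 𝓘(ℝ, E) c).target} :=
    contMDiffOn_extChartAt.mono fun x hx => by simpa using hx.1
  have h2 := hf.contMDiffOn.comp h1 fun x hx => hx.2.1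
  exact (contMDiffOn_extChartAt_symm c).comp h2 fun x hx => hx.2.2

variable {Z : Submodule ℂ (ComplexVF E M)} {F : Type*} [NormedAddCommGroup F] [NormedSpace ℂ F]
  (ι : F ≃ₗ[ℂ] Z) [FiniteDimensional ℂ F] [FiniteDimensional ℝ E]
  (hZ : IsComplexLieAlgebra Z) (htriv : TrivializesComplex Z) {c : M}

/-- The form of the frame, evaluated on a vector, is the field through that vector. -/
theorem field_form_chartDeriv {p : E} (hp : p ∈ (extChartAt 𝓘(ℝ, E) c).target) (v : E) :
    (ι ((chartFrame ι hZ htriv c).form p v) : ComplexVF E M) ((extChartAt 𝓘(ℝ, E) c).symm p) =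
      ⟨chartDeriv c p v, 0⟩ := by
  set z := (chartFrame ι hZ htriv c).form p v
  have h1 : chartRep c (reField ι z) p = v := (chartFrame ι hZ htriv c).re_form hp v
  have h2 : chartRep c (reField ι (Complex.I • z)) p = 0 :=
    (chartFrame ι hZ htriv c).re_I_form hp v
  have h3 := chartDeriv_chartRep hp (reField ι z)
  have h4 := chartDeriv_chartRep hp (reField ι (Complex.I • z))
  rw [h1] at h3
  rw [h2, map_zero, reField_I] at h4
  exact Complexification.ext h3.symm (neg_eq_zero.1 h4.symm)

theorem field_form_mfderiv {x : M} (hx : x ∈ (extChartAt 𝓘(ℝ, E) c).source)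
    (u : TangentSpace 𝓘(ℝ, E) x) :
    (ι ((chartFrame ι hZ htriv c).form (extChartAt 𝓘(ℝ, E) c x)
      (mfderiv 𝓘(ℝ, E) 𝓘(ℝ, E) (extChartAt 𝓘(ℝ, E) c) x u)) : ComplexVF E M) x = ⟨u, 0⟩ := by
  obtain ⟨p, hp, rfl⟩ : ∃ p ∈ (extChartAt 𝓘(ℝ, E) c).target, (extChartAt 𝓘(ℝ, E) c).symm p = x :=
    ⟨_, (extChartAt 𝓘(ℝ, E) c).map_source hx, (extChartAt 𝓘(ℝ, E) c).left_inv hx⟩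
  obtain ⟨v, rfl⟩ : ∃ v, chartDeriv c p v = u := ⟨_, chartDeriv_inverse hp u⟩
  have h := field_form_chartDeriv ι hZ htriv hp v
  rw [← h, (extChartAt 𝓘(ℝ, E) c).right_inv hp]
  exact congrArg (fun w => (ι ((chartFrame ι hZ htriv c).form p w) : ComplexVF E M) _)
    (mfderiv_chart_chartDeriv hp v)

variable {g : PseudoRiemannianMetric E M}

omit [FiniteDimensional ℝ E] in
-- The form is read off at one point; by `hconst` the choice of the point does not matter.
theorem exists_constant_form [Nonempty M]
    (hconst : ∀ u ∈ Z, ∀ v ∈ Z, ∃ c : ℂ, ∀ x : M, g.complexVal x (u x) (v x) = c) :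
    ∃ h : F →L[ℝ] F →L[ℝ] ℂ,
      (∀ y z x, h y z = g.complexVal x ((ι y : ComplexVF E M) x) ((ι z : ComplexVF E M) x)) ∧
      (∀ y z, h (Complex.I • y) z = Complex.I * h y z) ∧
      ∀ y z, h y (Complex.I • z) = Complex.I * h y z := by
  obtain ⟨x₀⟩ := ‹Nonempty M›
  have hs : ∀ (r : ℝ) (z : F), r • z = (r : ℂ) • z := fun r z => (Complex.coe_smul r z).symm
  have hadd : ∀ y z, (ι (y + z) : ComplexVF E M) x₀ =
    (ι y : ComplexVF E M) x₀ + (ι z : ComplexVF E M) x₀ := fun y z => by rw [map_add]; rfl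
  have hsmul : ∀ (a : ℂ) z, (ι (a • z) : ComplexVF E M) x₀ = a • (ι z : ComplexVF E M) x₀ :=
    fun a z => by rw [map_smul]; rfl
  refine ⟨LinearMap.toContinuousBilinearMap (LinearMap.mk₂ ℝ
    (fun y z => g.complexVal x₀ ((ι y : ComplexVF E M) x₀) ((ι z : ComplexVF E M) x₀))
    (fun x y z => ?_) (fun r y z => ?_) (fun x y z => ?_) (fun r y z => ?_)), fun y z x => ?_,
    fun y z => ?_, fun y z => ?_⟩
  · rw [hadd, g.complexVal_add_left]
  · rw [hs, hsmul, g.complexVal_smul_left, Complex.real_smul]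
  · rw [hadd, g.complexVal_add_right]
  · rw [hs, hsmul, g.complexVal_smul_right, Complex.real_smul]
  · obtain ⟨a, ha⟩ := hconst _ (ι y).2 _ (ι z).2
    exact (ha x₀).trans (ha x).symm
  · show g.complexVal _ _ _ = _ * g.complexVal _ _ _
    rw [hsmul, g.complexVal_smul_left]
  · show g.complexVal _ _ _ = _ * g.complexVal _ _ _
    rw [hsmul, g.complexVal_smul_right]

omit [FiniteDimensional ℝ E] in
theorem PseudoRiemannianMetric.complexVal_ofReal (x : M) (u v : TangentSpace 𝓘(ℝ, E) x) :
    g.complexVal x ⟨u, 0⟩ ⟨v, 0⟩ = (g.val x u v : ℂ) := by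
  apply Complex.ext <;> simp [complexVal]

variable {h : F →L[ℝ] F →L[ℝ] ℂ}
  (hg : ∀ y z x, h y z = g.complexVal x ((ι y : ComplexVF E M) x) ((ι z : ComplexVF E M) x))

include hg

/-- The metric is the pullback of the constant form `h` by the form of the frame; in particular this
pullback is real on real vectors. -/
theorem constant_form_chartDeriv {p : E} (hp : p ∈ (extChartAt 𝓘(ℝ, E) c).target) (v w : E) :
    h ((chartFrame ι hZ htriv c).form p v) ((chartFrame ι hZ htriv c).form p w) =
      (g.val ((extChartAt 𝓘(ℝ, E) c).symm p) (chartDeriv c p v) (chartDeriv c p w) : ℂ) := by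
  rw [hg _ _ ((extChartAt 𝓘(ℝ, E) c).symm p), field_form_chartDeriv ι hZ htriv hp,
    field_form_chartDeriv ι hZ htriv hp, PseudoRiemannianMetric.complexVal_ofReal]

theorem constant_form_mfderiv {x : M} (hx : x ∈ (extChartAt 𝓘(ℝ, E) c).source)
    (u v : TangentSpace 𝓘(ℝ, E) x) :
    h ((chartFrame ι hZ htriv c).form (extChartAt 𝓘(ℝ, E) c x)
      (mfderiv 𝓘(ℝ, E) 𝓘(ℝ, E) (extChartAt 𝓘(ℝ, E) c) x u))
      ((chartFrame ι hZ htriv c).form (extChartAt 𝓘(ℝ, E) c x)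
      (mfderiv 𝓘(ℝ, E) 𝓘(ℝ, E) (extChartAt 𝓘(ℝ, E) c) x v)) = (g.val x u v : ℂ) := by
  rw [hg _ _ x, field_form_mfderiv ι hZ htriv hx, field_form_mfderiv ι hZ htriv hx,
    PseudoRiemannianMetric.complexVal_ofReal]

include hZ htriv in
theorem eventually_locallyIsometricAt
    (hI_left : ∀ y z, h (Complex.I • y) z = Complex.I * h y z)
    (hI_right : ∀ y z, h y (Complex.I • z) = Complex.I * h y z) (c : M) :
    ∀ᶠ y in 𝓝 c, g.LocallyIsometricAt c y := by
  set ψ := extChartAt 𝓘(ℝ, E) c with hψ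
  have : FiniteDimensional ℝ F := FiniteDimensional.complexToReal F
  have : CompleteSpace F := FiniteDimensional.complete ℝ F
  set e := chartFrame ι hZ htriv c
  have hc : c ∈ ψ.source := mem_extChartAt_source c
  have hp₀ : ψ c ∈ ψ.target := mem_extChartAt_target c
  obtain ⟨U, X, hU, hUT, hpU, hX, hX0, hK⟩ := e.exists_killing h (fun p hp v w => by
    rw [constant_form_chartDeriv ι hZ htriv hg hp, Complex.ofReal_im]) hI_left hI_right hp₀
  have hev := eventually_exists_local_isometry hU hX
    (fun p hp => (e.hasFDerivAt_form (hUT hp)).differentiableAt.differentiableWithinAt) h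
    (fun p hp z v w => hK p hp z v w) hpU (by rw [hX0]; exact e.range_re hp₀)
  have hcont : Tendsto ψ (𝓝 c) (𝓝 (ψ c)) := continuousAt_extChartAt c
  filter_upwards [hcont.eventually hev,
    (isOpen_extChartAt_source (I := 𝓘(ℝ, E)) c).mem_nhds hc]
    with y ⟨φ, h1, h2, hs, ht, h3, h4, h5⟩ hy
  have hψt : ∀ x ∈ ψ.source, ψ x ∈ ψ.target := fun x hx => ψ.map_source hx
  have hsrc : ((chartAt E c).trans (φ.trans (chartAt E c).symm)).source ⊆
      {x | x ∈ ψ.source ∧ ψ x ∈ φ.source ∧ φ (ψ x) ∈ ψ.target} := by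
    intro x hx
    simp [hψ] at hx ⊢
    tauto
  have htgt : ((chartAt E c).trans (φ.trans (chartAt E c).symm)).target ⊆
      {x | x ∈ ψ.source ∧ ψ x ∈ φ.target ∧ φ.symm (ψ x) ∈ ψ.target} := by
    intro x hx
    simp [hψ] at hx ⊢
    tauto
  have hsm := (contMDiffOn_conj_chart c h3).mono hsrc
  refine ⟨(chartAt E c).trans (φ.trans (chartAt E c).symm), ?_, ?_, hsm,
    (contMDiffOn_conj_chart c h4).mono htgt, fun x hx u v => ?_⟩
  · have h6 : φ (ψ c) ∈ (chartAt E c).target := by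
      rw [h2]; simpa [hψ] using hψt y hy
    exact ⟨mem_chart_source E c, h1, h6⟩
  · show ψ.symm (φ (ψ c)) = y
    rw [h2, ψ.left_inv hy]
  · set χ := (chartAt E c).trans (φ.trans (chartAt E c).symm)
    obtain ⟨hx1, hx2, hx3⟩ := hsrc hx
    have hχx : χ x ∈ ψ.source := ψ.map_target hx3
    have hψχ : ∀ y ∈ χ.source, ψ (χ y) = φ (ψ y) := fun y hy => ψ.right_inv (hsrc hy).2.2
    have hdχ := ((hsm.contMDiffAt (χ.open_source.mem_nhds hx)).mdifferentiableAt
      (by simp)).hasMFDerivAt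
    have hdψ := ((contMDiffAt_chart hχx).mdifferentiableAt (by simp)).hasMFDerivAt
    have hdψ' := ((contMDiffAt_chart hx1).mdifferentiableAt (by simp)).hasMFDerivAt
    have hdφ := ((h3.contDiffAt (φ.open_source.mem_nhds hx2)).differentiableAt
      (by simp)).hasFDerivAt.hasMFDerivAt
    -- Differentiating this conjugation turns the invariance of `h` composed with the form under `φ`
    -- into the invariance of `g` under `χ`.
    have heq : ψ ∘ χ =ᶠ[𝓝 x] φ ∘ ψ := by
      filter_upwards [χ.open_source.mem_nhds hx] with y hy using hψχ y hy
    have hd := hasMFDerivAt_unique (hdψ.comp x hdχ) ((hdφ.comp x hdψ').congr_of_eventuallyEq heq)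
    have hd' : ∀ u : TangentSpace 𝓘(ℝ, E) x, (mfderiv 𝓘(ℝ, E) 𝓘(ℝ, E) ψ (χ x)
        (mfderiv 𝓘(ℝ, E) 𝓘(ℝ, E) χ x u) : E) =
        fderiv ℝ φ (ψ x) (mfderiv 𝓘(ℝ, E) 𝓘(ℝ, E) ψ x u) := fun u =>
      congrArg (fun L : E →L[ℝ] E => L u) hd
    have h6 := constant_form_mfderiv ι hZ htriv hg hχx (mfderiv 𝓘(ℝ, E) 𝓘(ℝ, E) χ x u)
      (mfderiv 𝓘(ℝ, E) 𝓘(ℝ, E) χ x v)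
    erw [hd' u, hd' v, hψχ x hx, h5 _ hx2,
      constant_form_mfderiv ι hZ htriv hg hx1] at h6
    exact_mod_cast h6.symm

end Chart

end

/-! ### Real forms and commutation with Killing fields -/

noncomputable section

open scoped Topology
open Set Filter VectorField

section RealForm

variable {E : Type*} [NormedAddCommGroup E] [NormedSpace ℝ E]
  {M : Type*} [TopologicalSpace M] [ChartedSpace E M]

/-- The real vector fields belonging to a space of complex ones. -/
def realFields (Z : Submodule ℂ (ComplexVF E M)) : Submodule ℝ (RealVF E M) where
  carrier := {v | v.toComplex ∈ Z}
  add_mem' {v w} hv hw := by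
    have h : RealVF.toComplex (v + w) = v.toComplex + w.toComplex :=
      funext fun x => Complexification.ext rfl (add_zero _).symm
    show RealVF.toComplex (v + w) ∈ Z
    rw [h]
    exact Z.add_mem hv hw
  zero_mem' := Z.zero_mem
  smul_mem' r v hv := by
    have h : RealVF.toComplex (r • v) = (r : ℂ) • v.toComplex :=
      funext fun x => by
        apply Complexification.ext
        · simp [RealVF.toComplex, -Complex.coe_smul]
        · simp [RealVF.toComplex, -Complex.coe_smul]
    show RealVF.toComplex (r • v) ∈ Z
    rw [h]
    exact Z.smul_mem _ hv

theorem RealVF.toComplex_mlieBracket (v w : RealVF E M) :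
    RealVF.toComplex (mlieBracket 𝓘(ℝ, E) v w) =
      ComplexVF.bracket v.toComplex w.toComplex := by
  have hi : ∀ v : RealVF E M, ComplexVF.im v.toComplex = 0 := fun _ => rfl
  have hr : ∀ v : RealVF E M, ComplexVF.re v.toComplex = v := fun _ => rfl
  funext x
  apply Complexification.ext
  · simp [ComplexVF.bracket, hi, hr, RealVF.toComplex]
  · simp [ComplexVF.bracket, hi, hr, RealVF.toComplex]

variable [IsManifold 𝓘(ℝ, E) ∞ M]

theorem isRealForm_realFields {Z : Submodule ℂ (ComplexVF E M)} (hZ : IsComplexLieAlgebra Z)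
    (htriv : TrivializesComplex Z) (hre : ClosedUnderRe Z) : IsRealForm (realFields Z) Z := by
  have hsm : ∀ v ∈ realFields Z, RealVF.Smooth v := fun v hv => (hZ.smooth _ hv).1
  refine ⟨⟨hsm, fun v hv w hw => ?_⟩, ⟨hsm, fun x => ⟨fun v w h => ?_, fun a => ?_⟩⟩,
    fun w => ⟨fun hw => ?_, ?_⟩⟩
  · show RealVF.toComplex _ ∈ Z
    rw [RealVF.toComplex_mlieBracket]
    exact hZ.bracket_mem _ hv _ hw
  · have h' : (⟨_, v.2⟩ : Z) = ⟨_, w.2⟩ := (htriv.2 x).1 (Complexification.ext h rfl)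
    exact Subtype.ext (congrArg (fun u : Z => ComplexVF.re (u : ComplexVF E M)) h')
  · obtain ⟨u, hu⟩ := (htriv.2 x).2 ⟨a, 0⟩
    exact ⟨⟨ComplexVF.re (u : ComplexVF E M), hre _ u.2⟩, congrArg Complexification.re hu⟩
  -- The imaginary part of `w` is the real part of `-i w`.
  · refine ⟨_, hre w hw, _, hre _ (Z.smul_mem (-Complex.I) hw), funext fun x => ?_⟩
    apply Complexification.ext
    · simp [RealVF.toComplex, ComplexVF.re]
    · simp [RealVF.toComplex, ComplexVF.re]
  · rintro ⟨a, ha, b, hb, rfl⟩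
    exact Z.add_mem ha (Z.smul_mem _ hb)

end RealForm

section Killing

variable {E : Type*} [NormedAddCommGroup E] [NormedSpace ℝ E] [FiniteDimensional ℝ E]
  {M : Type*} [TopologicalSpace M] [ChartedSpace E M] [IsManifold 𝓘(ℝ, E) ∞ M]
  {g : PseudoRiemannianMetric E M} {Z : Submodule ℂ (ComplexVF E M)}
  {F : Type*} [NormedAddCommGroup F] [NormedSpace ℂ F] (ι : F ≃ₗ[ℂ] Z) [FiniteDimensional ℂ F]
  (hZ : IsComplexLieAlgebra Z) (htriv : TrivializesComplex Z) {c : M} {h : F →L[ℝ] F →L[ℝ] ℂ}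
  (hg : ∀ y z x, h y z = g.complexVal x ((ι y : ComplexVF E M) x) ((ι z : ComplexVF E M) x))

include hg in
-- As g = h(θ ·, θ ·) with h constant, the product rule gives (L_X g)(Y₁, Y₂) = h((L_X θ) Y₁, θ Y₂)
-- + h(θ Y₁, (L_X θ) Y₂).
theorem isKillingOn_ofChart {U : Set E} (hU : IsOpen U) (hUT : U ⊆ (extChartAt 𝓘(ℝ, E) c).target)
    {X : E → E} (hX : ContDiffOn ℝ ∞ X U)
    (hK : ∀ p ∈ U, ∀ v w, h (lieForm (chartFrame ι hZ htriv c).form X p v)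
        ((chartFrame ι hZ htriv c).form p w) +
      h ((chartFrame ι hZ htriv c).form p v)
        (lieForm (chartFrame ι hZ htriv c).form X p w) = 0) :
    g.IsKillingOn (ofChart c X)
      ((extChartAt 𝓘(ℝ, E) c).source ∩ extChartAt 𝓘(ℝ, E) c ⁻¹' U) := by
  have : CompleteSpace E := FiniteDimensional.complete ℝ E
  have hsm : ∀ x ∈ (extChartAt 𝓘(ℝ, E) c).source ∩ extChartAt 𝓘(ℝ, E) c ⁻¹' U,
      ContMDiffAt 𝓘(ℝ, E) 𝓘(ℝ, E).tangent ∞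
        (fun x => (⟨x, ofChart c X x⟩ : TangentBundle 𝓘(ℝ, E) M)) x := fun x hx =>
    contMDiffAt_ofChart hx.1 (hX.contDiffAt (hU.mem_nhds hx.2))
  refine ⟨fun x hx => (hsm x hx).contMDiffWithinAt, fun Y₁ Y₂ x hx h₁ h₂ => ?_⟩
  have hV := hsm x hx
  obtain ⟨p, hp, rfl⟩ : ∃ p ∈ U, (extChartAt 𝓘(ℝ, E) c).symm p = x :=
    ⟨_, hx.2, (extChartAt 𝓘(ℝ, E) c).left_inv hx.1⟩
  have hpT := hUT hp
  set θ := (chartFrame ι hZ htriv c).form with hθ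
  have hgθ : ∀ q ∈ (extChartAt 𝓘(ℝ, E) c).target, ∀ v w,
      g.val ((extChartAt 𝓘(ℝ, E) c).symm q) (chartDeriv c q v) (chartDeriv c q w) =
        (h (θ q v) (θ q w)).re := fun q hq v w => by
    rw [constant_form_chartDeriv ι hZ htriv hg hq, Complex.ofReal_re]
  have hA := ((contDiffAt_chartRep hpT h₁).differentiableAt (by simp)).hasFDerivAt
  have hB := ((contDiffAt_chartRep hpT h₂).differentiableAt (by simp)).hasFDerivAt
  have hθp := (chartFrame ι hZ htriv c).hasFDerivAt_form hpT
  have hm : ∀ {V : RealVF E M}, ContMDiffAt 𝓘(ℝ, E) 𝓘(ℝ, E).tangent ∞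
      (fun x => (⟨x, V x⟩ : TangentBundle 𝓘(ℝ, E) M)) ((extChartAt 𝓘(ℝ, E) c).symm p) →
      MDifferentiableAt 𝓘(ℝ, E) 𝓘(ℝ, E).tangent
      (fun x => (⟨x, V x⟩ : TangentBundle 𝓘(ℝ, E) M)) ((extChartAt 𝓘(ℝ, E) c).symm p) :=
    fun hV => hV.mdifferentiableAt (by simp)
  have hVX : chartRep c (ofChart c X) =ᶠ[𝓝 p] X := by
    filter_upwards [hU.mem_nhds hp] with q hq using chartRep_ofChart (hUT hq) X
  have hbr : ∀ {Y : RealVF E M}, ContMDiffAt 𝓘(ℝ, E) 𝓘(ℝ, E).tangent ∞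
      (fun x => (⟨x, Y x⟩ : TangentBundle 𝓘(ℝ, E) M)) ((extChartAt 𝓘(ℝ, E) c).symm p) →
      mlieBracket 𝓘(ℝ, E) (ofChart c X) Y ((extChartAt 𝓘(ℝ, E) c).symm p) =
        chartDeriv c p (fderiv ℝ (chartRep c Y) p (X p) -
          fderiv ℝ X p (chartRep c Y p)) := fun {Y} hY => by
    rw [← chartDeriv_chartRep hpT (mlieBracket 𝓘(ℝ, E) (ofChart c X) Y),
      chartRep_mlieBracket hpT (hm hV) (hm hY),
      hVX.lieBracket_vectorField_eq EventuallyEq.rfl, lieBracket_eq]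
  have h1 := hθp.clm_apply hA
  have h2 := hθp.clm_apply hB
  have h3 : HasFDerivAt (fun q => h (θ q (chartRep c Y₁ q))) _ p :=
    (h.hasFDerivAt (𝕜 := ℝ) (E := F) (F := F →L[ℝ] ℂ)).comp p h1
  have h4 := h3.clm_apply h2
  have h5 : HasFDerivAt (fun q => (h (θ q (chartRep c Y₁ q)) (θ q (chartRep c Y₂ q))).re) _ p :=
    Complex.reCLM.hasFDerivAt.comp p h4
  have h6 : (fun q => g.val ((extChartAt 𝓘(ℝ, E) c).symm q)
      (Y₁ ((extChartAt 𝓘(ℝ, E) c).symm q)) (Y₂ ((extChartAt 𝓘(ℝ, E) c).symm q))) =ᶠ[𝓝 p]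
      fun q => (h (θ q (chartRep c Y₁ q)) (θ q (chartRep c Y₂ q))).re := by
    filter_upwards [(isOpen_extChartAt_target c).mem_nhds hpT] with q hq
    rw [← hgθ q hq, chartDeriv_chartRep hq, chartDeriv_chartRep hq]
  have h7 := mvfderiv_chartDeriv hpT (f := fun x => g.val x (Y₁ x) (Y₂ x))
    (h5.congr_of_eventuallyEq h6) (X p)
  rw [PseudoRiemannianMetric.lieDeriv, hbr h₁, hbr h₂, ← chartDeriv_chartRep hpT Y₁,
    ← chartDeriv_chartRep hpT Y₂, hgθ p hpT, hgθ p hpT, chartDeriv_of_ofChart hpT, h7]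
  have h8 := congrArg Complex.re (hK p hp (chartRep c Y₁ p) (chartRep c Y₂ p))
  simp only [lieForm, map_add, map_sub, add_apply, sub_apply, Complex.add_re, Complex.sub_re,
    Complex.zero_re] at h8 ⊢
  simp [hθ] at h8 ⊢
  linarith

include hg in
/-- The real parts of the fields have locally constant parameters if the fields commute with all
local Killing fields. -/
theorem fderiv_form_frameRe_eq_zero
    (hI_left : ∀ y z, h (Complex.I • y) z = Complex.I * h y z)
    (hI_right : ∀ y z, h y (Complex.I • z) = Complex.I * h y z)
    (hcomm : ∀ u ∈ Z, ∀ (U : Set M) (v : RealVF E M), IsOpen U → g.IsKillingOn v U →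
      ∀ x ∈ U, ComplexVF.bracket u (RealVF.toComplex v) x = 0)
    {p : E} (hp : p ∈ (extChartAt 𝓘(ℝ, E) c).target) (y : F) :
    fderiv ℝ (fun q => (chartFrame ι hZ htriv c).form q (frameRe ι c q y)) p = 0 := by
  have : CompleteSpace E := FiniteDimensional.complete ℝ E
  set e := chartFrame ι hZ htriv c
  obtain ⟨U, X, hU, hUT, hpU, hX, hX0, hK⟩ := e.exists_killing h (fun p hp v w => by
    rw [constant_form_chartDeriv ι hZ htriv hg hp, Complex.ofReal_im]) hI_left hI_right hp
  ext v
  -- Every tangent vector at `p` is the value of one of the Killing fields, so it suffices to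
  -- differentiate along these.
  obtain ⟨z, rfl⟩ : ∃ z, X p z = v := ⟨e.form p v, by rw [hX0, e.re_form hp]⟩
  have hXz : ContDiffOn ℝ ∞ (fun q => X q z) U := hX.clm_apply contDiffOn_const
  refine e.fderiv_form_re_eq_zero hp (X := fun q => X q z) (fun y => ?_) y
  have hKill := isKillingOn_ofChart ι hZ htriv hg hU hUT hXz fun p hp v w => hK p hp z v w
  have hxs : (extChartAt 𝓘(ℝ, E) c).symm p ∈ (extChartAt 𝓘(ℝ, E) c).source :=
    (extChartAt 𝓘(ℝ, E) c).map_target hp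
  have hpsi := (extChartAt 𝓘(ℝ, E) c).right_inv hp
  -- Only the real part of the hypothesis matters here: the Killing field commutes with the real
  -- part of the field.
  have h1 := congrArg Complexification.re (hcomm _ (ι y).2 _ _
    ((continuousOn_extChartAt c).isOpen_inter_preimage (isOpen_extChartAt_source c) hU) hKill
    ((extChartAt 𝓘(ℝ, E) c).symm p) ⟨hxs, by rwa [mem_preimage, hpsi]⟩)
  have hi : ∀ v : RealVF E M, ComplexVF.im v.toComplex = 0 := fun _ => rfl
  have hr : ∀ v : RealVF E M, ComplexVF.re v.toComplex = v := fun _ => rfl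
  simp only [ComplexVF.bracket, hi, hr, mlieBracket_zero_right, Pi.zero_apply, sub_zero,
    Complexification.zero_re] at h1
  have h2 : chartRep c (mlieBracket 𝓘(ℝ, E) (reField ι y) (ofChart c fun q => X q z)) p = 0 := by
    rw [chartRep]
    exact (congrArg _ h1).trans (map_zero _)
  have hVX : chartRep c (ofChart c fun q => X q z) =ᶠ[𝓝 p] fun q => X q z := by
    filter_upwards [hU.mem_nhds hpU] with q hq using chartRep_ofChart (hUT hq) _
  have hXp : ContDiffAt ℝ ∞ (fun q => X q z)
      (extChartAt 𝓘(ℝ, E) c ((extChartAt 𝓘(ℝ, E) c).symm p)) := by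
    rw [hpsi]
    exact hXz.contDiffAt (hU.mem_nhds hpU)
  rw [chartRep_mlieBracket hp ((smooth_reField ι hZ y).contMDiffAt.mdifferentiableAt (by simp))
    ((contMDiffAt_ofChart hxs hXp).mdifferentiableAt (by simp)),
    EventuallyEq.rfl.lieBracket_vectorField_eq hVX, lieBracket_eq, sub_eq_zero] at h2
  exact h2.trans (e.fderiv_re_apply hp (X p z) y)

include ι hZ htriv hg in
-- Here `k x` is the parameter of the element of `Z` that agrees with the real part of `w` at `x`.
-- On a ball in a chart its derivative vanishes, so it is locally constant, and by connectedness a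
-- single element of `Z` equals the real part of `w` everywhere.
theorem closedUnderRe_of_commute [ConnectedSpace M]
    (hI_left : ∀ y z, h (Complex.I • y) z = Complex.I * h y z)
    (hI_right : ∀ y z, h y (Complex.I • z) = Complex.I * h y z)
    (hcomm : ∀ u ∈ Z, ∀ (U : Set M) (v : RealVF E M), IsOpen U → g.IsKillingOn v U →
      ∀ x ∈ U, ComplexVF.bracket u (RealVF.toComplex v) x = 0) : ClosedUnderRe Z := by
  intro w hw
  obtain ⟨y, hy⟩ := ι.surjective ⟨w, hw⟩
  have hyw : (ι y : ComplexVF E M) = w := by rw [hy]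
  have hk : ∀ x, ∃ k : F, (ι k : ComplexVF E M) x = ⟨(w x).re, 0⟩ := fun x => by
    obtain ⟨u, hu⟩ := (htriv.2 x).2 ⟨(w x).re, 0⟩
    exact ⟨ι.symm u, by rw [ι.apply_symm_apply]; exact hu⟩
  choose k hk using hk
  have hloc : IsLocallyConstant k := by
    rw [IsLocallyConstant.iff_eventually_eq]
    intro c
    set e := chartFrame ι hZ htriv c
    have hkG : ∀ q ∈ (extChartAt 𝓘(ℝ, E) c).target,
        k ((extChartAt 𝓘(ℝ, E) c).symm q) = e.form q (frameRe ι c q y) := fun q hq => by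
      refine ι.injective ((htriv.2 ((extChartAt 𝓘(ℝ, E) c).symm q)).1 ?_)
      refine (hk _).trans ((field_form_chartDeriv ι hZ htriv hq _).trans ?_).symm
      rw [frameRe_apply, chartDeriv_chartRep hq, reField, hyw]
      rfl
    obtain ⟨r, hr, hball⟩ := Metric.isOpen_iff.1 (isOpen_extChartAt_target (I := 𝓘(ℝ, E)) c) _
      (mem_extChartAt_target c)
    have hG : ∀ q ∈ Metric.ball (extChartAt 𝓘(ℝ, E) c c) r, DifferentiableAt ℝ
        (fun q => e.form q (frameRe ι c q y)) q := fun q hq =>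
      ((e.hasFDerivAt_form (hball hq)).clm_apply ((e.hasFDerivAt_re (hball hq)).clm_apply
        (hasFDerivAt_const y q))).differentiableAt
    have hev : ∀ᶠ x in 𝓝 c, extChartAt 𝓘(ℝ, E) c x ∈ Metric.ball (extChartAt 𝓘(ℝ, E) c c) r :=
      (continuousAt_extChartAt (I := 𝓘(ℝ, E)) c).eventually (Metric.ball_mem_nhds _ hr)
    have hkx : ∀ x ∈ (extChartAt 𝓘(ℝ, E) c).source, k x =
        e.form (extChartAt 𝓘(ℝ, E) c x) (frameRe ι c (extChartAt 𝓘(ℝ, E) c x) y) := fun x hx => by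
      rw [← hkG _ ((extChartAt 𝓘(ℝ, E) c).map_source hx), (extChartAt 𝓘(ℝ, E) c).left_inv hx]
    filter_upwards [hev, (isOpen_extChartAt_source (I := 𝓘(ℝ, E)) c).mem_nhds
      (mem_extChartAt_source c)] with x hx hxs
    rw [hkx x hxs, hkx c (mem_extChartAt_source c)]
    exact Metric.isOpen_ball.is_const_of_fderiv_eq_zero (convex_ball _ _).isPreconnected
      (fun q hq => (hG q hq).differentiableWithinAt)
      (fun q hq => fderiv_form_frameRe_eq_zero ι hZ htriv hg hI_left hI_right hcomm (hball hq) y)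
      hx (Metric.mem_ball_self hr)
  obtain ⟨c⟩ : Nonempty M := inferInstance
  have h1 : RealVF.toComplex (ComplexVF.re w) = (ι (k c) : ComplexVF E M) := funext fun x => by
    rw [hloc.apply_eq_of_preconnectedSpace c x]
    exact (hk x).symm
  rw [h1]
  exact (ι (k c)).2

end Killing

/-! ### Finite-dimensionality of the Lie algebra -/

section Dimension

variable {V : Type*} [AddCommGroup V] [Module ℝ V]

/-- The complexification of a finite-dimensional space is finite-dimensional. -/
theorem Complexification.finiteDimensional [FiniteDimensional ℝ V] :
    FiniteDimensional ℂ (Complexification V) := by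
  let b := Module.finBasis ℝ V
  refine Module.Finite.of_surjective (M := Fin (Module.finrank ℝ V) → ℂ)
    (Fintype.linearCombination ℂ fun i => (⟨b i, 0⟩ : Complexification V)) fun w => ?_
  set S := (Fintype.linearCombination ℂ fun i => (⟨b i, 0⟩ : Complexification V)).range
  have hmem : ∀ v : V, (⟨v, 0⟩ : Complexification V) ∈ S := fun v => by
    induction b.mem_span v using Submodule.span_induction with
    | mem v hv =>
      obtain ⟨i, rfl⟩ := hv
      exact ⟨Pi.single i 1, by simp [Fintype.linearCombination_apply_single]⟩
    | zero => exact S.zero_mem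
    | add u v _ _ hu hv =>
      have h : (⟨u + v, 0⟩ : Complexification V) = ⟨u, 0⟩ + ⟨v, 0⟩ := by
        apply Complexification.ext <;> simp
      rw [h]
      exact S.add_mem hu hv
    | smul r v _ hv =>
      have h : (⟨r • v, 0⟩ : Complexification V) = (r : ℂ) • ⟨v, 0⟩ := by
        apply Complexification.ext <;> simp [-Complex.coe_smul]
      rw [h]
      exact S.smul_mem _ hv
  have h : w = ⟨w.re, 0⟩ + Complex.I • ⟨w.im, 0⟩ := by
    apply Complexification.ext <;> simp
  rw [h]
  exact S.add_mem (hmem _) (S.smul_mem _ (hmem _))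

variable {E : Type*} [NormedAddCommGroup E] [NormedSpace ℝ E] [FiniteDimensional ℝ E]
  {M : Type*} [TopologicalSpace M] [ChartedSpace E M] [IsManifold 𝓘(ℝ, E) ∞ M]

theorem TrivializesComplex.finiteDimensional [Nonempty M] {Z : Submodule ℂ (ComplexVF E M)}
    (htriv : TrivializesComplex Z) : FiniteDimensional ℂ Z := by
  obtain ⟨x⟩ := ‹Nonempty M›
  have : FiniteDimensional ℝ (TangentSpace 𝓘(ℝ, E) x) := ‹FiniteDimensional ℝ E›
  have : FiniteDimensional ℂ (Complexification (TangentSpace 𝓘(ℝ, E) x)) :=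
    Complexification.finiteDimensional
  exact Module.Finite.of_injective ((LinearMap.proj x).comp Z.subtype :
    Z →ₗ[ℂ] Complexification (TangentSpace 𝓘(ℝ, E) x)) (htriv.2 x).1

end Dimension

end

theorem lemma12p4 {E : Type*} [NormedAddCommGroup E] [NormedSpace ℝ E] [FiniteDimensional ℝ E]
    {M : Type*} [TopologicalSpace M] [T2Space M] [ConnectedSpace M] [ChartedSpace E M]
    [IsManifold 𝓘(ℝ, E) ∞ M] (g : PseudoRiemannianMetric E M)
    (Z : Submodule ℂ (ComplexVF E M)) (hZ : IsComplexLieAlgebra Z) (htriv : TrivializesComplex Z)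
    (hconst : ∀ u ∈ Z, ∀ v ∈ Z, ∃ c : ℂ, ∀ x : M, g.complexVal x (u x) (v x) = c) :
    g.LocallyHomogeneous ∧
      ((∀ u ∈ Z, ∀ (U : Set M) (v : RealVF E M), IsOpen U → g.IsKillingOn v U →
          ∀ x ∈ U, ComplexVF.bracket u (RealVF.toComplex v) x = 0) →
        ClosedUnderRe Z ∧ ∃ X : Submodule ℝ (RealVF E M), IsRealForm X Z) := by
  have : FiniteDimensional ℂ Z := htriv.finiteDimensional
  -- The parameter space is ℂⁿ rather than `Z` itself, since the calculus of maps into it requires a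
  -- norm.
  let ι := (Module.finBasis ℂ Z).equivFun.symm
  obtain ⟨h, hg, hI_left, hI_right⟩ := exists_constant_form ι hconst
  refine ⟨PseudoRiemannianMetric.locallyHomogeneous_of_eventually
    (eventually_locallyIsometricAt ι hZ htriv hg hI_left hI_right), fun hcomm => ?_⟩
  have hre := closedUnderRe_of_commute ι hZ htriv hg hI_left hI_right hcomm
  exact ⟨hre, realFields Z, isRealForm_realFields hZ htriv hre⟩
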